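/- Let $\mathbb K$ be a field of characteristic zero. An admissible directed graph with $n\ge 1$ external vertices (labelled $1,\dots,n$) and $m\ge 0$ internal vertices (unlabelled) is a directed graph with a linear order on its edges, without double edges (two edges with the same source and the same target) and simple loops, in which every internal vertex has at most one incoming and at most two outgoing edges and is connected by an (undirected) path with an external vertex. Graphs that differ by a permutation $\sigma$ of the order of the edges are identified up to the sign of $\sigma$. The generalized IHX relations state the following: replace an internal vertex $v$ with at most one incoming and at most three outgoing edges (the rest of the graph being admissible) by two internal vertices joined by a new directed edge, placed last in the order, and sum over all ways of reconnecting the edges adjacent to $v$ to these two vertices that give admissible graphs; the sum is zero. Let $\mathsf{dgraphs}(n)$ be the resulting space of graphs modulo these relations, graded by $|\Gamma|=2\,\#\{\text{internal vertices}\}-\#\{\text{edges}\}$ and completed with respect to the number of internal vertices. For $1\le i\le n$ the composition $\Gamma_1\circ_i\Gamma_2$ inserts $\Gamma_2$ at the $i$-th external vertex of $\Gamma_1$ and sums over all ways of reconnecting the edges at that vertex to vertices of $\Gamma_2$ that give admissible graphs, the edges of $\Gamma_1$ preceding those of $\Gamma_2$. Let $\mathfrak g_{\mathsf{As},\mathsf{dgraphs}}=\prod_{n\ge1}s^{-n+1}\mathsf{dgraphs}(n)$,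 in which $\Gamma\in\mathsf{dgraphs}(n)$ has degree $|\Gamma|+n-1$, with the graded Lie bracket that is the graded commutator of $$\Gamma_1\star\Gamma_2=\sum_{i=1}^n(-1)^{|\Gamma_2|(1-n)+(i+1)(m-1)}\,\Gamma_1\circ_i\Gamma_2,\qquad \Gamma_1\in\mathsf{dgraphs}(n),\ \Gamma_2\in\mathsf{dgraphs}(m).$$ Two elements $\alpha,\beta$ of degree one (in particular two Maurer–Cartan elements, i.e. elements with $\alpha\star\alpha=0$) are called gauge equivalent if $\beta=\exp(\mathrm{ad}_\xi)\alpha=\sum_{k\ge0}\frac1{k!}\mathrm{ad}_\xi^k\alpha$ for some $\xi$ of degree zero for which this series converges, in the sense that its component in any given numbers of external and internal vertices is eventually constant. Let $a_1\in\mathsf{dgraphs}(1)$ be the sum of the two graphs with one external vertex, one internal vertex and a single edge between them (it encodes the Chevalley–Eilenberg differential $d_A$), and let $a_2\in\mathsf{dgraphs}(2)$ be the graph with two external vertices and nothing else (it encodes the commutative product). Put $\alpha_0=a_1+a_2$ and $\alpha_{\mathrm{Duf}}=a_1+\tilde m_{\mathrm{Duf}}$. Here $\tilde m_{\mathrm{Duf}}\in\mathsf{dgraphs}(2)$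 is the universal graph series of the product induced by the Duflo map (which, as a product, is Kontsevich's product), $$\tilde m_{\mathrm{Duf}}=J^{-1/2}\circ_1\big((G\circ_2J^{1/2})\circ_1J^{1/2}\big),$$ where an internal vertex with ordered outgoing edges to $a,b$ stands for the bracket $[a,b]$; $G\in\mathsf{dgraphs}(2)$, the product pulled back from $U\mathfrak g$ by symmetrization, is the exponential (for superposition of graphs with common external vertices) of the series of trees representing $\log(e^Xe^Y)-X-Y$, written as a Lie series by Dynkin's formula; and $J^{\pm1/2}\in\mathsf{dgraphs}(1)$ is $\exp\big(\pm\sum_{k\ge1}\frac{B_{2k}}{4k\,(2k)!}W_{2k}\big)$, with $B_{2k}$ the Bernoulli numbers and $W_{2k}$ the wheel with $2k$ spokes representing $\mathrm{tr}(\mathrm{ad}_x^{2k})$. Then the elements $\alpha_{\mathrm{Duf}}$ and $\alpha_0$ are not gauge equivalent. -/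

import Mathlib

namespace DufloGraph

/-- Vertices: `n` labelled external ones (`inl`), `m` internal ones (`inr`). -/
abbrev Vtx (n m : ℕ) : Type := Fin n ⊕ Fin m

/-- The vector space with basis the directed edges `(source, target)`. -/
abbrev EdgeSpace (K : Type*) [Field K] (n m : ℕ) : Type _ := (Vtx n m × Vtx n m) →₀ K

/-- Directed graphs on the vertices `Vtx n m` (internal vertices numbered for the time being) with a
linear order on their edges: the graph with edges `e₁ < ... < e_k` is the monomial `e₁ ∧ ... ∧ e_k`.
Permuting the order of the edges gives the sign of the permutation, and a graph with a double edge
is zero. -/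
abbrev GraphAlg (K : Type*) [Field K] (n m : ℕ) : Type _ := ExteriorAlgebra K (EdgeSpace K n m)

/-- The graph with the single edge `a → b`. -/
noncomputable def edge (K : Type*) [Field K] {n m : ℕ} (a b : Vtx n m) : GraphAlg K n m :=
  ExteriorAlgebra.ι K (Finsupp.single (a, b) (1 : K))

/-- The graph with the given ordered list of edges. -/
noncomputable def graph (K : Type*) [Field K] {n m : ℕ} (l : List (Vtx n m × Vtx n m)) :
    GraphAlg K n m :=
  (l.map fun e => edge K e.1 e.2).prod

/-- Replace the edge `a → b` by the sum of all edges from a vertex in `f a` to a vertex in `f b`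
(simple loops are not allowed and are sent to zero). -/
noncomputable def reconnectEdge (K : Type*) [Field K] {n m n' m' : ℕ}
    (f : Vtx n m → Finset (Vtx n' m')) : EdgeSpace K n m →ₗ[K] EdgeSpace K n' m' :=
  Finsupp.linearCombination K fun e : Vtx n m × Vtx n m =>
    if e.1 = e.2 then 0 else ∑ a ∈ f e.1, ∑ b ∈ f e.2, Finsupp.single (a, b) (1 : K)

/-- Sum over all ways to replace every endpoint `a` of every edge by a vertex in `f a`, keeping the
order of the edges. -/
noncomputable def reconnect (K : Type*) [Field K] {n m n' m' : ℕ}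
    (f : Vtx n m → Finset (Vtx n' m')) : GraphAlg K n m →ₐ[K] GraphAlg K n' m' :=
  ExteriorAlgebra.map (reconnectEdge K f)

/-- The internal vertex `v` is replaced by two vertices: one that takes the place of `v`, and a new
one, which gets the number `w`. All other vertices stay. -/
def splitVtx {n m : ℕ} (w : Fin (m + 1)) (v : Fin m) : Vtx n m → Finset (Vtx n (m + 1))
  | Sum.inl j => {Sum.inl j}
  | Sum.inr u => if u = v then {Sum.inr (w.succAbove u), Sum.inr w} else {Sum.inr (w.succAbove u)}

/-- The relations between graphs with `n` external and `m` internal vertices.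
* `loop`, `incoming`, `outgoing`: a graph with a simple loop, or with an internal vertex with two
  incoming or three outgoing edges, is zero ("keeping only admissible graphs").
* `relabel`: internal vertices are unlabelled.
* `ihx`: the generalized IHX relations. The vertex `v` is replaced by two vertices joined by a new
  directed edge, which is placed last, and one sums over all ways to reconnect the edges that were
  adjacent to `v`. By the first three relations only admissible graphs survive in the sum, and the
  relation has content only if `v` has at most one incoming and at most three outgoing edges. -/
inductive Rel (K : Type*) [Field K] (n : ℕ) : (m : ℕ) → GraphAlg K n m → Prop
  | loop {m : ℕ} (x y : GraphAlg K n m) (a : Vtx n m) : Rel K n m (x * edge K a a * y)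
  | incoming {m : ℕ} (x y : GraphAlg K n m) (v : Fin m) (a b : Vtx n m) :
      Rel K n m (x * (edge K a (Sum.inr v) * edge K b (Sum.inr v)) * y)
  | outgoing {m : ℕ} (x y : GraphAlg K n m) (v : Fin m) (a b c : Vtx n m) :
      Rel K n m (x * (edge K (Sum.inr v) a * edge K (Sum.inr v) b * edge K (Sum.inr v) c) * y)
  | relabel {m : ℕ} (x : GraphAlg K n m) (σ : Equiv.Perm (Fin m)) :
      Rel K n m (reconnect K (fun a => {Sum.map id σ a}) x - x)
  | ihx {m : ℕ} (x : GraphAlg K n m) (w : Fin (m + 1)) (v : Fin m) :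
      Rel K n (m + 1)
        (reconnect K (splitVtx w v) x * edge K (Sum.inr (w.succAbove v)) (Sum.inr w))

/-- The span of the relations. -/
noncomputable def relations (K : Type*) [Field K] (n m : ℕ) : Submodule K (GraphAlg K n m) :=
  Submodule.span K {x | Rel K n m x}

/-- Graphs modulo all relations. -/
abbrev GraphQuot (K : Type*) [Field K] (n m : ℕ) : Type _ := GraphAlg K n m ⧸ relations K n m

/-- The vertices of the graph inserted into the `i`-th external vertex (counted from `0`) of a graph
with `n₁ + 1` external and `m₁` internal vertices, as vertices of the composition. -/
def innerVtx {n₁ n₂ m₁ m₂ N M : ℕ} (hN : n₁ + n₂ = N) (hM : m₁ + m₂ = M) (i : Fin (n₁ + 1)) :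
    Vtx (n₂ + 1) m₂ → Vtx (N + 1) M
  | Sum.inl k => Sum.inl ⟨i + k, by omega⟩
  | Sum.inr u => Sum.inr ⟨m₁ + u, by omega⟩

/-- The vertices of the outer graph: the `i`-th external vertex is replaced by all the vertices of
the inserted graph, so that edges at this vertex are reconnected in all possible ways. -/
def outerVtx {n₁ n₂ m₁ m₂ N M : ℕ} (hN : n₁ + n₂ = N) (hM : m₁ + m₂ = M) (i : Fin (n₁ + 1)) :
    Vtx (n₁ + 1) m₁ → Finset (Vtx (N + 1) M)
  | Sum.inl k =>
      if k < i then {Sum.inl ⟨k, by omega⟩}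
      else if k = i then Finset.univ.image (innerVtx hN hM i)
      else {Sum.inl ⟨k + n₂, by omega⟩}
  | Sum.inr u => {Sum.inr ⟨u, by omega⟩}

/-- An admissible directed graph: no double edges, no simple loops, every internal vertex has at most
one incoming and at most two outgoing edges (so is at most trivalent), and every internal vertex is
connected by a path with an external vertex. -/
structure Admissible {n m : ℕ} (l : List (Vtx n m × Vtx n m)) : Prop where
  nodup : l.Nodup
  noLoop : ∀ e ∈ l, e.1 ≠ e.2
  incoming : ∀ v : Fin m, l.countP (fun e => e.2 = Sum.inr v) ≤ 1
  outgoing : ∀ v : Fin m, l.countP (fun e => e.1 = Sum.inr v) ≤ 2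
  connected : ∀ v : Fin m, ∃ j : Fin n,
    Relation.ReflTransGen (fun a b => (a, b) ∈ l ∨ (b, a) ∈ l) (Sum.inr v) (Sum.inl j)

/-- The part of `dgraphs(n)` that is spanned by the admissible graphs with `m` internal vertices and
of degree `d`, where the degree of a graph is `2 * #(internal vertices) - #(edges)`. -/
noncomputable def dgraphs (K : Type*) [Field K] (n m : ℕ) (d : ℤ) :
    Submodule K (GraphQuot K n m) :=
  Submodule.span K {x | ∃ l : List (Vtx n m × Vtx n m), Admissible l ∧
    2 * (m : ℤ) - (l.length : ℤ) = d ∧ x = Submodule.Quotient.mk (graph K l)}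

/-! The next facts show that insertion of graphs is compatible with the relations. -/

theorem reconnect_edge (K : Type*) [Field K] {n m n' m' : ℕ}
    (f : Vtx n m → Finset (Vtx n' m')) (a b : Vtx n m) :
    reconnect K f (edge K a b) =
      if a = b then 0 else ∑ a' ∈ f a, ∑ b' ∈ f b, edge K a' b' := by
  unfold reconnect edge
  rw [ExteriorAlgebra.map_apply_ι]
  simp only [reconnectEdge, Finsupp.linearCombination_single, one_smul]
  split_ifs <;> simp [map_sum]

theorem reconnect_reconnect (K : Type*) [Field K] {n m n' m' n'' m'' : ℕ}
    {f : Vtx n m → Finset (Vtx n' m')} {g : Vtx n' m' → Finset (Vtx n'' m'')}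
    (hf : Pairwise fun a b => Disjoint (f a) (f b)) (hg : Pairwise fun a b => Disjoint (g a) (g b))
    (x : GraphAlg K n m) :
    reconnect K g (reconnect K f x) = reconnect K (fun a => (f a).biUnion g) x := by
  have key : (reconnect K g).comp (reconnect K f) =
      reconnect K (fun a => (f a).biUnion g) := by
    apply ExteriorAlgebra.hom_ext
    apply Finsupp.lhom_ext'
    rintro ⟨a, b⟩
    apply LinearMap.ext_ring
    change reconnect K g (reconnect K f (edge K a b)) = reconnect K _ (edge K a b)
    rw [reconnect_edge, reconnect_edge]
    by_cases hab : a = b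
    · simp [hab]
    · simp only [hab, if_false, map_sum]
      rw [Finset.sum_biUnion (fun _ _ _ _ h => hg h)]
      refine Finset.sum_congr rfl fun a' ha' => ?_
      have h2 : ∀ c, ∑ d ∈ (f b).biUnion g, edge K c d = ∑ b' ∈ f b, ∑ d ∈ g b', edge K c d :=
        fun c => Finset.sum_biUnion (fun _ _ _ _ h => hg h)
      rw [Finset.sum_congr rfl fun c _ => h2 c, Finset.sum_comm]
      refine Finset.sum_congr rfl fun b' hb' => ?_
      rw [reconnect_edge, if_neg]
      rintro rfl
      exact Finset.disjoint_left.mp (hf hab) ha' hb'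
  exact DFunLike.congr_fun key x


theorem pairwise_single {n m n' m' : ℕ} {f : Vtx n m → Vtx n' m'} (hf : Function.Injective f) :
    Pairwise fun a b => Disjoint ({f a} : Finset (Vtx n' m')) {f b} := by
  intro a b h
  simpa using fun h' => h (hf h')

theorem innerVtx_injective {n₁ n₂ m₁ m₂ N M : ℕ} (hN : n₁ + n₂ = N) (hM : m₁ + m₂ = M)
    (i : Fin (n₁ + 1)) : Function.Injective (innerVtx (m₂ := m₂) hN hM i) := by
  rintro (a | a) (b | b) h <;> simp [innerVtx, Fin.ext_iff] at h ⊢ <;> omega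

theorem outerVtx_pairwise {n₁ n₂ m₁ m₂ N M : ℕ} (hN : n₁ + n₂ = N) (hM : m₁ + m₂ = M)
    (i : Fin (n₁ + 1)) :
    Pairwise fun a b => Disjoint (outerVtx (m₂ := m₂) hN hM i a) (outerVtx hN hM i b) := by
  intro a b hab
  rw [Finset.disjoint_left]
  intro c hc hc'
  rcases a with (a | a) <;> rcases b with (b | b) <;> rcases c with (c | c) <;>
    simp only [outerVtx] at hc hc' <;> (try split_ifs at hc hc') <;>
    simp [innerVtx, Fin.ext_iff] at * <;> omega

theorem splitVtx_pairwise {n m : ℕ} (w : Fin (m + 1)) (v : Fin m) :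
    Pairwise fun a b : Vtx n m => Disjoint (splitVtx w v a) (splitVtx w v b) := by
  intro a b hab
  rw [Finset.disjoint_left]
  intro c hc hc'
  rcases a with (a | a) <;> rcases b with (b | b) <;>
    simp only [splitVtx] at hc hc' <;> (try split_ifs at hc hc') <;>
    rcases c with (c | c) <;>
    simp only [Finset.mem_singleton, Finset.mem_insert, Sum.inl.injEq, Sum.inr.injEq, ne_eq,
      reduceCtorEq, or_self] at * <;>
    grind [Fin.succAbove_ne, Fin.succAbove_right_injective]

theorem reconnect_edge_single (K : Type*) [Field K] {n m n' m' : ℕ} (f : Vtx n m → Vtx n' m')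
    (a b : Vtx n m) :
    reconnect K (fun a => {f a}) (edge K a b) = if a = b then 0 else edge K (f a) (f b) := by
  rw [reconnect_edge]; simp

theorem edge_mul (K : Type*) [Field K] {n m : ℕ} (a b : Vtx n m) (x : GraphAlg K n m) :
    edge K a b * x = ExteriorAlgebra.map (-LinearMap.id) x * edge K a b := by
  induction x using ExteriorAlgebra.induction with
  | algebraMap r => simp [Algebra.commutes]
  | ι z =>
    rw [ExteriorAlgebra.map_apply_ι]
    have := ExteriorAlgebra.ι_add_mul_swap (R := K) (Finsupp.single (a, b) (1 : K)) z
    simp only [LinearMap.neg_apply, LinearMap.id_apply, map_neg, neg_mul]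
    exact eq_neg_of_add_eq_zero_left this
  | mul x y hx hy => rw [map_mul, ← mul_assoc, hx, mul_assoc, hy, mul_assoc]
  | add x y hx hy => rw [map_add, mul_add, add_mul, hx, hy]

theorem parity_reconnect (K : Type*) [Field K] {n m n' m' : ℕ}
    (f : Vtx n m → Finset (Vtx n' m')) (x : GraphAlg K n m) :
    ExteriorAlgebra.map (-LinearMap.id) (reconnect K f x) =
      reconnect K f (ExteriorAlgebra.map (-LinearMap.id) x) := by
  have : (ExteriorAlgebra.map (-LinearMap.id)).comp (reconnect K f) =
      (reconnect K f).comp (ExteriorAlgebra.map (-LinearMap.id)) := by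
    unfold reconnect
    rw [ExteriorAlgebra.map_comp_map, ExteriorAlgebra.map_comp_map]
    congr 1
    ext; simp
  exact DFunLike.congr_fun this x

theorem mem_relations {K : Type*} [Field K] {n m : ℕ} {x : GraphAlg K n m} (h : Rel K n m x) :
    x ∈ relations K n m := Submodule.subset_span h

theorem outerVtx_biUnion {n₁ n₂ m₁ m₂ N M m₁' m₂' M' : ℕ} (hN : n₁ + n₂ = N) (hM : m₁ + m₂ = M)
    (hM' : m₁' + m₂' = M') (i : Fin (n₁ + 1)) (g : Vtx (N + 1) M → Finset (Vtx (N + 1) M'))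
    (t : Fin m₁ → Fin m₁')
    (hl : ∀ k, g (Sum.inl k) = {Sum.inl k})
    (hr : Finset.univ.image (innerVtx (m₂ := m₂') hN hM' i) =
      (Finset.univ.image (innerVtx (m₂ := m₂) hN hM i)).biUnion g)
    (ht : ∀ u : Fin m₁, g (Sum.inr ⟨u, by omega⟩) = {Sum.inr ⟨t u, by omega⟩})
    (a : Vtx (n₁ + 1) m₁) :
    (outerVtx (m₂ := m₂) hN hM i a).biUnion g =
      outerVtx (m₂ := m₂') hN hM' i (Sum.map id t a) := by
  rcases a with k | u
  · simp only [outerVtx, Sum.map_inl, id]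
    split_ifs
    · rw [Finset.singleton_biUnion, hl]
    · rw [hr]
    · rw [Finset.singleton_biUnion, hl]
  · simp only [outerVtx, Sum.map_inr]
    rw [Finset.singleton_biUnion, ht]

theorem innerVtx_inr {n₁ n₂ m₁ m₂ N M : ℕ} (hN : n₁ + n₂ = N) (hM : m₁ + m₂ = M)
    (i : Fin (n₁ + 1)) (u : Fin m₂) :
    innerVtx hN hM i (Sum.inr u) = Sum.inr ⟨m₁ + u, by omega⟩ := rfl

theorem innerVtx_inl {n₁ n₂ m₁ m₂ N M : ℕ} (hN : n₁ + n₂ = N) (hM : m₁ + m₂ = M)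
    (i : Fin (n₁ + 1)) (k : Fin (n₂ + 1)) :
    innerVtx (m₂ := m₂) hN hM i (Sum.inl k) = Sum.inl ⟨i + k, by omega⟩ := rfl

theorem splitVtx_self {n m : ℕ} (w : Fin (m + 1)) (v : Fin m) :
    splitVtx w v (Sum.inr v : Vtx n m) = {Sum.inr (w.succAbove v), Sum.inr w} := by
  simp [splitVtx]

theorem splitVtx_ne {n m : ℕ} (w : Fin (m + 1)) {u v : Fin m} (h : u ≠ v) :
    splitVtx w v (Sum.inr u : Vtx n m) = {Sum.inr (w.succAbove u)} := by
  simp [splitVtx, h]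

theorem mem_splitVtx {n m : ℕ} (w : Fin (m + 1)) (u v : Fin m) (c : Vtx n (m + 1)) :
    c ∈ splitVtx w v (Sum.inr u : Vtx n m) ↔
      c = Sum.inr (w.succAbove u) ∨ (u = v ∧ c = Sum.inr w) := by
  by_cases h : u = v
  · subst h; simp [splitVtx]
  · simp [splitVtx, h]

theorem succAbove_shift {m₁ m : ℕ} (w : Fin (m + 1)) (u : Fin m) :
    (⟨m₁ + w, by omega⟩ : Fin (m₁ + m + 1)).succAbove ⟨m₁ + u, by omega⟩ =
      ⟨m₁ + w.succAbove u, by omega⟩ := by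
  simp only [Fin.succAbove, Fin.lt_def, Fin.ext_iff, Fin.val_castSucc]
  by_cases h : (u : ℕ) < w <;> simp [h] <;> omega

theorem succAbove_cast {m₂ m : ℕ} (w : Fin (m + 1)) (u : Fin m) :
    (⟨w, by omega⟩ : Fin (m + m₂ + 1)).succAbove ⟨u, by omega⟩ =
      ⟨w.succAbove u, by omega⟩ := by
  simp only [Fin.succAbove, Fin.lt_def, Fin.ext_iff, Fin.val_castSucc]
  by_cases h : (u : ℕ) < w <;> simp [h]

theorem comp_rel_right {K : Type*} [Field K] {n₁ n₂ m₁ m₂ N M : ℕ} (hN : n₁ + n₂ = N)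
    (hM : m₁ + m₂ = M) (i : Fin (n₁ + 1)) (x : GraphAlg K (n₁ + 1) m₁)
    {y : GraphAlg K (n₂ + 1) m₂} (hy : Rel K (n₂ + 1) m₂ y) :
    reconnect K (outerVtx (m₂ := m₂) hN hM i) x *
      reconnect K (fun a => {innerVtx hN hM i a}) y ∈ relations K (N + 1) M := by
  cases hy with
  | loop p q a => simp [reconnect_edge]
  | incoming p q v a b =>
    simp only [map_mul, reconnect_edge_single]
    split_ifs
    all_goals try simp only [zero_mul, mul_zero]; exact Submodule.zero_mem _
    rw [← mul_assoc, ← mul_assoc]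
    exact mem_relations (Rel.incoming _ _ _ _ _)
  | outgoing p q v a b c =>
    simp only [map_mul, reconnect_edge_single]
    split_ifs
    all_goals try simp only [zero_mul, mul_zero]; exact Submodule.zero_mem _
    rw [← mul_assoc, ← mul_assoc]
    exact mem_relations (Rel.outgoing _ _ _ _ _ _)
  | relabel y σ =>
    subst hM
    let τ : Equiv.Perm (Fin (m₁ + m₂)) := finSumFinEquiv.permCongr (Equiv.sumCongr 1 σ)
    have h₁ : ∀ u : Fin m₁, τ ⟨u, by omega⟩ = ⟨u, by omega⟩ := fun u => by
      change τ (Fin.castAdd m₂ u) = Fin.castAdd m₂ u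
      simp [τ, Equiv.permCongr_apply]
    have h₂ : ∀ u : Fin m₂, τ ⟨m₁ + u, by omega⟩ = ⟨m₁ + σ u, by omega⟩ := fun u => by
      change τ (Fin.natAdd m₁ u) = Fin.natAdd m₁ (σ u)
      simp [τ, Equiv.permCongr_apply]
    have hτ : Function.Injective (Sum.map id τ : Vtx (N + 1) (m₁ + m₂) → _) :=
      Function.injective_id.sumMap τ.injective
    have hσ : Function.Injective (Sum.map id σ : Vtx (n₂ + 1) m₂ → _) :=
      Function.injective_id.sumMap σ.injective
    have hc : ∀ a : Vtx (n₂ + 1) m₂, Sum.map id τ (innerVtx hN rfl i a) =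
        innerVtx hN rfl i (Sum.map id σ a) := by
      rintro (k | u)
      · rfl
      · simp [innerVtx, h₂]
    have e₁ : reconnect K (fun a => {Sum.map id τ a})
        (reconnect K (outerVtx (m₂ := m₂) hN rfl i) x) = reconnect K (outerVtx hN rfl i) x := by
      rw [reconnect_reconnect K (outerVtx_pairwise _ _ _) (pairwise_single hτ)]
      congr 2
      funext a
      rw [outerVtx_biUnion hN rfl rfl i (fun a => {Sum.map id τ a}) id (fun _ => rfl) ?_
        (fun u => by simp [h₁]), Sum.map_id_id, id]
      rw [Finset.biUnion_singleton, Finset.image_image]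
      ext c
      simp only [Finset.mem_image, Finset.mem_univ, true_and, Function.comp_apply, hc]
      constructor
      · rintro ⟨a, rfl⟩
        exact ⟨Sum.map id σ.symm a, by rcases a with a | a <;> simp⟩
      · rintro ⟨a, rfl⟩
        exact ⟨_, rfl⟩
    have e₂ : reconnect K (fun a => {Sum.map id τ a})
        (reconnect K (fun a => {innerVtx hN rfl i a}) y) =
        reconnect K (fun a => {innerVtx hN rfl i a}) (reconnect K (fun a => {Sum.map id σ a}) y) := by
      rw [reconnect_reconnect K (pairwise_single (innerVtx_injective _ _ _)) (pairwise_single hτ),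
        reconnect_reconnect K (pairwise_single hσ) (pairwise_single (innerVtx_injective _ _ _))]
      congr 2
      funext a
      rw [Finset.singleton_biUnion, Finset.singleton_biUnion, hc]
    rw [map_sub, mul_sub, ← e₂]
    nth_rewrite 1 [← e₁]
    rw [← map_mul]
    exact mem_relations (Rel.relabel _ _)
  | @ihx m y w v =>
    obtain rfl : M = m₁ + m + 1 := by omega
    have hc : ∀ a : Vtx (n₂ + 1) m,
        (splitVtx w v a).image (innerVtx (m₁ := m₁) hN hM i) =
        splitVtx (⟨m₁ + w, by omega⟩ : Fin (m₁ + m + 1)) ⟨m₁ + v, by omega⟩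
          (innerVtx (m₁ := m₁) hN rfl i a) := by
      rintro (k | u)
      · rfl
      · ext c
        simp only [innerVtx_inr, mem_splitVtx, succAbove_shift, Finset.mem_image]
        constructor
        · rintro ⟨a, (rfl | ⟨rfl, rfl⟩), rfl⟩
          · exact Or.inl rfl
          · exact Or.inr ⟨rfl, rfl⟩
        · rintro (rfl | ⟨h, rfl⟩)
          · exact ⟨_, Or.inl rfl, rfl⟩
          · refine ⟨_, Or.inr ⟨?_, rfl⟩, rfl⟩
            simpa [Fin.ext_iff] using h
    have e₁ : reconnect K (outerVtx (m₂ := m + 1) hN hM i) x =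
        reconnect K (splitVtx (⟨m₁ + w, by omega⟩ : Fin (m₁ + m + 1)) ⟨m₁ + v, by omega⟩)
          (reconnect K (outerVtx (m₂ := m) hN rfl i) x) := by
      rw [reconnect_reconnect K (outerVtx_pairwise _ _ _) (splitVtx_pairwise _ _)]
      congr 2
      funext a
      rw [outerVtx_biUnion hN rfl hM i _ id (fun _ => rfl) ?_ ?_, Sum.map_id_id, id]
      · ext c
        simp only [Finset.mem_biUnion, Finset.mem_image, Finset.mem_univ, true_and,
          exists_exists_eq_and, ← hc]
        constructor
        · rintro ⟨a, rfl⟩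
          rcases a with k | u
          · exact ⟨Sum.inl k, Sum.inl k, by simp [splitVtx], rfl⟩
          · rcases Fin.eq_self_or_eq_succAbove w u with rfl | ⟨u', rfl⟩
            · exact ⟨Sum.inr v, Sum.inr u, by simp [splitVtx], rfl⟩
            · exact ⟨Sum.inr u', _, (mem_splitVtx _ _ _ _).2 (Or.inl rfl), rfl⟩
        · rintro ⟨_, a, _, rfl⟩
          exact ⟨a, rfl⟩
      · intro u
        rw [splitVtx_ne _ (by simp [Fin.ext_iff]; omega)]
        congr 2
        rw [Fin.succAbove_of_castSucc_lt _ _ (by simp [Fin.lt_def]; omega)]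
        rfl
    have e₂ : reconnect K (fun a => {innerVtx (m₁ := m₁) hN hM i a}) (reconnect K (splitVtx w v) y) =
        reconnect K (splitVtx (⟨m₁ + w, by omega⟩ : Fin (m₁ + m + 1)) ⟨m₁ + v, by omega⟩)
          (reconnect K (fun a => {innerVtx hN rfl i a}) y) := by
      rw [reconnect_reconnect K (splitVtx_pairwise _ _) (pairwise_single (innerVtx_injective _ _ _)),
        reconnect_reconnect K (pairwise_single (innerVtx_injective _ _ _)) (splitVtx_pairwise _ _)]
      congr 2
      funext a
      rw [Finset.singleton_biUnion, Finset.biUnion_singleton, hc]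
    rw [map_mul, e₂, e₁, reconnect_edge_single, if_neg (by simp [Fin.succAbove_ne]), ← mul_assoc,
      ← map_mul, innerVtx_inr, innerVtx_inr, ← succAbove_shift]
    exact mem_relations (Rel.ihx _ _ _)

theorem reconnect_edge_inr (K : Type*) [Field K] {n m n' m' : ℕ}
    {f : Vtx n m → Finset (Vtx n' m')} {v : Fin m} {v' : Fin m'}
    (hv : f (Sum.inr v) = {Sum.inr v'}) (a : Vtx n m) :
    reconnect K f (edge K a (Sum.inr v)) =
      ∑ a' ∈ (if a = Sum.inr v then ∅ else f a), edge K a' (Sum.inr v') := by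
  rw [reconnect_edge]
  split_ifs <;> simp [hv]

theorem reconnect_inr_edge (K : Type*) [Field K] {n m n' m' : ℕ}
    {f : Vtx n m → Finset (Vtx n' m')} {v : Fin m} {v' : Fin m'}
    (hv : f (Sum.inr v) = {Sum.inr v'}) (a : Vtx n m) :
    reconnect K f (edge K (Sum.inr v) a) =
      ∑ a' ∈ (if Sum.inr v = a then ∅ else f a), edge K (Sum.inr v') a' := by
  rw [reconnect_edge]
  split_ifs <;> simp [hv]

theorem comp_rel_left {K : Type*} [Field K] {n₁ n₂ m₁ m₂ N M : ℕ} (hN : n₁ + n₂ = N)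
    (hM : m₁ + m₂ = M) (i : Fin (n₁ + 1)) {x : GraphAlg K (n₁ + 1) m₁}
    (y : GraphAlg K (n₂ + 1) m₂) (hx : Rel K (n₁ + 1) m₁ x) :
    reconnect K (outerVtx (m₂ := m₂) hN hM i) x *
      reconnect K (fun a => {innerVtx hN hM i a}) y ∈ relations K (N + 1) M := by
  have hv : ∀ v : Fin m₁, outerVtx (m₂ := m₂) hN hM i (Sum.inr v) =
    {Sum.inr ⟨v, by omega⟩} := fun _ => rfl
  cases hx with
  | loop p q a => simp [reconnect_edge]
  | incoming p q v a b =>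
    simp only [map_mul, reconnect_edge_inr K (hv v)]
    simp only [Finset.sum_mul, Finset.mul_sum]
    refine Submodule.sum_mem _ fun a' _ => Submodule.sum_mem _ fun b' _ => ?_
    rw [mul_assoc _ _ (reconnect K _ y)]
    exact mem_relations (Rel.incoming _ _ _ _ _)
  | outgoing p q v a b c =>
    simp only [map_mul, reconnect_inr_edge K (hv v)]
    simp only [Finset.sum_mul, Finset.mul_sum]
    refine Submodule.sum_mem _ fun a' _ => Submodule.sum_mem _ fun b' _ =>
      Submodule.sum_mem _ fun c' _ => ?_
    rw [mul_assoc _ _ (reconnect K _ y)]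
    exact mem_relations (Rel.outgoing _ _ _ _ _ _)
  | relabel x σ =>
    subst hM
    let τ : Equiv.Perm (Fin (m₁ + m₂)) := finSumFinEquiv.permCongr (Equiv.sumCongr σ 1)
    have h₁ : ∀ u : Fin m₁, τ ⟨u, by omega⟩ = ⟨σ u, by omega⟩ := fun u => by
      change τ (Fin.castAdd m₂ u) = Fin.castAdd m₂ (σ u)
      simp [τ, Equiv.permCongr_apply]
    have h₂ : ∀ u : Fin m₂, τ ⟨m₁ + u, by omega⟩ = ⟨m₁ + u, by omega⟩ := fun u => by
      change τ (Fin.natAdd m₁ u) = Fin.natAdd m₁ u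
      simp [τ, Equiv.permCongr_apply]
    have hτ : Function.Injective (Sum.map id τ : Vtx (N + 1) (m₁ + m₂) → _) :=
      Function.injective_id.sumMap τ.injective
    have hσ : Function.Injective (Sum.map id σ : Vtx (n₁ + 1) m₁ → _) :=
      Function.injective_id.sumMap σ.injective
    have hc : ∀ a : Vtx (n₂ + 1) m₂, Sum.map id τ (innerVtx hN rfl i a) =
        innerVtx hN rfl i a := by
      rintro (k | u)
      · rfl
      · simp [innerVtx, h₂]
    have e₁ : reconnect K (fun a => {Sum.map id τ a})
        (reconnect K (outerVtx (m₂ := m₂) hN rfl i) x) =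
        reconnect K (outerVtx hN rfl i) (reconnect K (fun a => {Sum.map id σ a}) x) := by
      rw [reconnect_reconnect K (outerVtx_pairwise _ _ _) (pairwise_single hτ),
        reconnect_reconnect K (pairwise_single hσ) (outerVtx_pairwise _ _ _)]
      congr 2
      funext a
      rw [outerVtx_biUnion hN rfl rfl i (fun a => {Sum.map id τ a}) σ (fun _ => rfl) ?_
        (fun u => by simp [h₁]), Finset.singleton_biUnion]
      rw [Finset.biUnion_singleton, Finset.image_image]
      congr 1
      funext a
      exact (hc a).symm
    have e₂ : reconnect K (fun a => {Sum.map id τ a})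
        (reconnect K (fun a => {innerVtx hN rfl i a}) y) =
        reconnect K (fun a => {innerVtx hN rfl i a}) y := by
      rw [reconnect_reconnect K (pairwise_single (innerVtx_injective _ _ _)) (pairwise_single hτ)]
      congr 2
      funext a
      rw [Finset.singleton_biUnion, hc]
    rw [map_sub, sub_mul, ← e₁]
    nth_rewrite 1 [← e₂]
    rw [← map_mul]
    exact mem_relations (Rel.relabel _ _)
  | @ihx m x w v =>
    obtain rfl : M = m + m₂ + 1 := by omega
    let W : Fin (m + m₂ + 1) := ⟨w, by omega⟩
    let V : Fin (m + m₂) := ⟨v, by omega⟩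
    have hc : ∀ a : Vtx (n₂ + 1) m₂, splitVtx W V (innerVtx (m₁ := m) hN rfl i a) =
        {innerVtx hN hM i a} := by
      rintro (k | u)
      · rfl
      · rw [innerVtx_inr, innerVtx_inr, splitVtx_ne _ (by simp [V, Fin.ext_iff]; omega),
          Fin.succAbove_of_le_castSucc _ _ (by simp [W, Fin.le_def]; omega)]
        simp [Fin.ext_iff]
        omega
    have e₁ : reconnect K (outerVtx (m₂ := m₂) hN hM i) (reconnect K (splitVtx w v) x) =
        reconnect K (splitVtx W V) (reconnect K (outerVtx (m₂ := m₂) hN rfl i) x) := by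
      rw [reconnect_reconnect K (splitVtx_pairwise _ _) (outerVtx_pairwise _ _ _),
        reconnect_reconnect K (outerVtx_pairwise _ _ _) (splitVtx_pairwise _ _)]
      congr 2
      funext a
      rcases a with k | u
      · simp only [splitVtx, Finset.singleton_biUnion, outerVtx]
        split_ifs
        · rfl
        · rw [Finset.image_biUnion]
          simp only [hc]
          rw [Finset.biUnion_singleton]
        · rfl
      · ext c
        simp only [outerVtx, Finset.singleton_biUnion, mem_splitVtx, Finset.mem_biUnion, W, V,
          succAbove_cast]
        constructor
        · rintro ⟨_, (rfl | ⟨rfl, rfl⟩), h⟩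
          · exact Or.inl (by simpa [outerVtx] using h)
          · exact Or.inr ⟨rfl, by simpa [outerVtx] using h⟩
        · rintro (rfl | ⟨h, rfl⟩)
          · exact ⟨_, Or.inl rfl, by simp⟩
          · exact ⟨_, Or.inr ⟨by simpa [Fin.ext_iff] using h, rfl⟩, by simp⟩
    have e₂ : reconnect K (fun a => {innerVtx (m₁ := m + 1) hN hM i a}) y =
        reconnect K (splitVtx W V) (reconnect K (fun a => {innerVtx hN rfl i a}) y) := by
      rw [reconnect_reconnect K (pairwise_single (innerVtx_injective _ _ _)) (splitVtx_pairwise _ _)]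
      congr 2
      funext a
      rw [Finset.singleton_biUnion, hc]
    have e₃ : reconnect K (outerVtx (m₂ := m₂) hN hM i)
        (edge K (Sum.inr (w.succAbove v)) (Sum.inr w)) =
        edge K (Sum.inr (W.succAbove V)) (Sum.inr W) := by
      rw [reconnect_edge, if_neg (by simp [Fin.succAbove_ne])]
      simp [outerVtx, W, V, succAbove_cast]
    rw [map_mul, e₁, e₂, e₃, mul_assoc, edge_mul, parity_reconnect, ← mul_assoc, ← map_mul]
    exact mem_relations (Rel.ihx _ _ _)

/-- Insertion of graphs at the `i`-th external vertex, before passing to the quotient. The edges of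
the outer graph come before those of the inserted graph. -/
noncomputable def compAux (K : Type*) [Field K] {n₁ n₂ m₁ m₂ N M : ℕ} (hN : n₁ + n₂ = N)
    (hM : m₁ + m₂ = M) (i : Fin (n₁ + 1)) :
    GraphAlg K (n₁ + 1) m₁ →ₗ[K] GraphAlg K (n₂ + 1) m₂ →ₗ[K] GraphAlg K (N + 1) M :=
  (LinearMap.mul K (GraphAlg K (N + 1) M)).compl₁₂
    (reconnect K (outerVtx (m₂ := m₂) hN hM i)).toLinearMap
    (reconnect K fun a => {innerVtx hN hM i a}).toLinearMap

/-- The operadic composition `Γ₁ ∘ᵢ Γ₂` (external vertices are counted from `0`). -/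
noncomputable def comp (K : Type*) [Field K] {n₁ n₂ m₁ m₂ N M : ℕ} (hN : n₁ + n₂ = N)
    (hM : m₁ + m₂ = M) (i : Fin (n₁ + 1)) :
    GraphQuot K (n₁ + 1) m₁ →ₗ[K] GraphQuot K (n₂ + 1) m₂ →ₗ[K] GraphQuot K (N + 1) M :=
  Submodule.liftQ (relations K (n₁ + 1) m₁)
    (LinearMap.flip (Submodule.liftQ (relations K (n₂ + 1) m₂)
      (((compAux K hN hM i).compr₂ (relations K (N + 1) M).mkQ).flip) (by
        refine Submodule.span_le.2 fun y hy => LinearMap.ext fun x => ?_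
        exact (Submodule.Quotient.mk_eq_zero _).2 (comp_rel_right hN hM i x hy))))
    (by
      refine Submodule.span_le.2 fun x hx => LinearMap.ext fun y => ?_
      obtain ⟨y, rfl⟩ := Submodule.Quotient.mk_surjective _ y
      exact (Submodule.Quotient.mk_eq_zero _).2 (comp_rel_left hN hM i y hx))

theorem comp_mk (K : Type*) [Field K] {n₁ n₂ m₁ m₂ N M : ℕ} (hN : n₁ + n₂ = N)
    (hM : m₁ + m₂ = M) (i : Fin (n₁ + 1)) (x : GraphAlg K (n₁ + 1) m₁)
    (y : GraphAlg K (n₂ + 1) m₂) :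
    comp K hN hM i (Submodule.Quotient.mk x) (Submodule.Quotient.mk y) =
      Submodule.Quotient.mk (reconnect K (outerVtx (m₂ := m₂) hN hM i) x *
        reconnect K (fun a => {innerVtx hN hM i a}) y) :=
  rfl

/-- Formal series of graphs with `n` external vertices: one term for every number of internal
vertices. -/
abbrev Series (K : Type*) [Field K] (n : ℕ) : Type _ := ∀ m : ℕ, GraphQuot K n m

/-- The operadic composition, extended to formal series of graphs. -/
noncomputable def seriesComp (K : Type*) [Field K] {n₁ n₂ N : ℕ} (hN : n₁ + n₂ = N)
    (i : Fin (n₁ + 1)) (x : Series K (n₁ + 1)) (y : Series K (n₂ + 1)) : Series K (N + 1) :=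
  fun M => ∑ r : Finset.HasAntidiagonal.antidiagonal M,
    comp K hN (Finset.HasAntidiagonal.mem_antidiagonal.1 r.2) i (x r.1.1) (y r.1.2)

/-- Families of formal series of graphs, one for every arity; the index `n` stands for arity
`n + 1`. -/
abbrev Family (K : Type*) [Field K] : Type _ := ∀ n : ℕ, Series K (n + 1)

/-- The degree `p` part of the convolution Lie algebra, that is, of the product over all arities
`n + 1` of the `n`-fold shifted spaces of (series of) admissible graphs: a graph of degree `d` and
arity `n + 1` has degree `d + n` here. -/
noncomputable def convolution (K : Type*) [Field K] (p : ℤ) : Submodule K (Family K) where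
  carrier := {x | ∀ n m : ℕ, x n m ∈ dgraphs K (n + 1) m (p - n)}
  add_mem' hx hy := fun n m => Submodule.add_mem _ (hx n m) (hy n m)
  zero_mem' := fun _ _ => Submodule.zero_mem _
  smul_mem' c _ hx := fun n m => Submodule.smul_mem _ c (hx n m)

/-- The pre-Lie product `x ⋆ y`, where `y` has degree `q`. In arities `n = p.1.1 + 1` of `x` and
`m = p.1.2 + 1` of `y` it is the sum over `i = 1, ..., n` of
`(-1) ^ (|y| * (1 - n) + (i + 1) * (m - 1))` times `x ∘ᵢ y`, where `|y| = q - (m - 1)` is the degree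
of the graphs in `y`. -/
noncomputable def preLieMul (K : Type*) [Field K] (q : ℤ) (x y : Family K) : Family K :=
  fun N M => ∑ p : Finset.HasAntidiagonal.antidiagonal N, ∑ i : Fin (p.1.1 + 1),
    ((-1 : K) ^ ((q - p.1.2) * (1 - ((p.1.1 : ℤ) + 1)) + (((i : ℤ) + 1) + 1) * p.1.2)) •
      seriesComp K (Finset.HasAntidiagonal.mem_antidiagonal.1 p.2) i (x p.1.1) (y p.1.2) M

/-- The graded commutator `[x, y]` of an element `x` of degree `p` and an element `y` of degree
`q`. -/
noncomputable def bracket (K : Type*) [Field K] (p q : ℤ) (x y : Family K) : Family K :=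
  preLieMul K q x y - ((-1 : K) ^ (p * q)) • preLieMul K p y x

/-- Gauge equivalence of degree one elements: `β = exp (ad ξ) α` for some `ξ` of degree zero. The
exponential series is required to converge in the complete topology of formal series, that is, in
each component (given numbers of external and internal vertices) its partial sums are eventually
constant. -/
def GaugeEquiv (K : Type*) [Field K] (α β : Family K) : Prop :=
  ∃ ξ ∈ convolution K 0, ∀ n m : ℕ, ∃ B : ℕ, ∀ b ≥ B,
    (∑ k ∈ Finset.range b, ((k.factorial : K)⁻¹) • (bracket K 0 1 ξ)^[k] α) n m = β n m

/-! ### The two elements -/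

/-- The element of the convolution Lie algebra with components `a` in arity one, `b` in arity two,
and zero in all higher arities. -/
noncomputable def strictElement (K : Type*) [Field K] (a : Series K 1) (b : Series K 2) : Family K
  | 0 => a
  | 1 => b
  | _ + 2 => 0

/-- The Chevalley-Eilenberg differential: the sum of the two graphs with one external and one
internal vertex and a single edge between them. -/
noncomputable def differential (K : Type*) [Field K] : Series K 1
  | 1 => Submodule.Quotient.mk (edge K (Sum.inr 0) (Sum.inl 0) + edge K (Sum.inl 0) (Sum.inr 0))
  | _ => 0

/-- The commutative product: the graph with two external vertices and nothing else. -/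
noncomputable def commProduct (K : Type*) [Field K] : Series K 2
  | 0 => Submodule.Quotient.mk 1
  | _ => 0

/-- The coefficient of the word `w` in `e^X e^Y`, where the letters `0`, `1` stand for the
non-commuting variables `X`, `Y`. -/
def expCoeff (w : List (Fin 2)) : ℚ :=
  if w = List.replicate (w.count 0) 0 ++ List.replicate (w.count 1) 1 then
    1 / ((w.count 0).factorial * (w.count 1).factorial)
  else 0

/-- The coefficient of the word `w` in `(e^X e^Y - 1) ^ r`. -/
def powCoeff : ℕ → List (Fin 2) → ℚ
  | 0, w => if w = [] then 1 else 0
  | r + 1, w => ∑ k ∈ Finset.Icc 1 w.length, expCoeff (w.take k) * powCoeff r (w.drop k)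

/-- The coefficient of the word `w` in the Baker-Campbell-Hausdorff series `log (e^X e^Y)`. -/
def bchCoeff (w : List (Fin 2)) : ℚ :=
  ∑ r ∈ Finset.Icc 1 w.length, (-1) ^ (r - 1) / (r : ℚ) * powCoeff r w

/-- The tree of the iterated bracket `[w₀, [w₁, ..., [w_{m-1}, w_m]]]` of two external vertices: an
internal vertex with outgoing edges to `a`, `b` (in this order) is the bracket `[a, b]`, and its
incoming edge, if any, comes from the bracket into which `[a, b]` is inserted. -/
noncomputable def bracketTree (K : Type*) [Field K] {m : ℕ} (w : Fin (m + 1) → Fin 2) :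
    GraphAlg K 2 m :=
  graph K ((List.finRange m).flatMap fun k =>
    [(Sum.inr k, Sum.inl (w k.castSucc)),
      (Sum.inr k, if h : k.1 + 1 < m then Sum.inr ⟨k.1 + 1, h⟩ else Sum.inl (w (Fin.last m)))])

/-- `log (e^X e^Y) - X - Y` as a series of trees, by the formula of Dynkin: the Lie series is
obtained from the series of words by replacing each word of length `m + 1` by `1 / (m + 1)` times
its iterated bracket. -/
noncomputable def bchTrees (K : Type*) [Field K] (m : ℕ) : GraphAlg K 2 m :=
  if m = 0 then 0
  else ∑ w : Fin (m + 1) → Fin 2,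
    ((bchCoeff (List.ofFn w) / ((m : ℚ) + 1) : ℚ) : K) • bracketTree K w

/-- Superposition of graphs: the external vertices are shared, the internal vertices and the edges
are those of both graphs. -/
noncomputable def superpose (K : Type*) [Field K] {n m₁ m₂ M : ℕ} (hM : m₁ + m₂ = M)
    (x : GraphAlg K n m₁) (y : GraphAlg K n m₂) : GraphAlg K n M :=
  reconnect K (fun a => {Sum.map id (fun u : Fin m₁ => (⟨u, by omega⟩ : Fin M)) a}) x *
    reconnect K (fun a => {Sum.map id (fun u : Fin m₂ => (⟨m₁ + u, by omega⟩ : Fin M)) a}) y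

/-- The powers of `bchTrees` for superposition. -/
noncomputable def bchPow (K : Type*) [Field K] : ℕ → (M : ℕ) → GraphAlg K 2 M
  | 0, M => if M = 0 then 1 else 0
  | j + 1, M => ∑ r : Finset.HasAntidiagonal.antidiagonal M,
      superpose K (Finset.HasAntidiagonal.mem_antidiagonal.1 r.2) (bchTrees K r.1.1) (bchPow K j r.1.2)

/-- The product on `Sg` that is pulled back from `Ug` by the symmetrization map: the bidifferential
operator with symbol `exp ⟨x, log (e^X e^Y) - X - Y⟩`, that is, the exponential of `bchTrees` for
superposition. -/
noncomputable def symProduct (K : Type*) [Field K] : Series K 2 :=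
  fun M => ∑ j ∈ Finset.range (M + 1),
    ((j.factorial : K)⁻¹) • (Submodule.Quotient.mk (bchPow K j M) : GraphQuot K 2 M)

/-- The wheel with `m` spokes, i.e. the symbol `tr (ad_x ^ m)`: a directed cycle of internal
vertices, each of which has one outgoing edge to the external vertex and one to the next internal
vertex. -/
noncomputable def wheel (K : Type*) [Field K] (m : ℕ) : GraphAlg K 1 m :=
  graph K ((List.finRange m).flatMap fun k =>
    [(Sum.inr k, Sum.inl 0), (Sum.inr k, Sum.inr ⟨(k.1 + 1) % m, Nat.mod_lt _ k.pos⟩)])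

/-- `s * log J^(1/2)` as a series of wheels, where
`J(x) = det ((e^(ad_x/2) - e^(-ad_x/2)) / ad_x)`, so that `log J^(1/2)(x)` is the sum over even
`m ≥ 2` of `B_m / (2 * m * m!) * tr (ad_x ^ m)`, with the Bernoulli numbers `B_m` (which vanish for
odd `m ≥ 3`). -/
noncomputable def wheelSeries (K : Type*) [Field K] (s : ℚ) : Series K 1 :=
  fun m => if 2 ≤ m then
    ((s * (bernoulli m / (2 * m * m.factorial)) : ℚ) : K) • Submodule.Quotient.mk (wheel K m)
  else 0

/-- The powers of `wheelSeries` for composition. -/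
noncomputable def wheelPow (K : Type*) [Field K] (s : ℚ) : ℕ → Series K 1
  | 0 => fun M => if M = 0 then Submodule.Quotient.mk 1 else 0
  | j + 1 => seriesComp K (n₁ := 0) (n₂ := 0) rfl 0 (wheelSeries K s) (wheelPow K s j)

/-- The differential operator `J^(s/2)` of infinite order with constant coefficients. -/
noncomputable def dufloFactor (K : Type*) [Field K] (s : ℚ) : Series K 1 :=
  fun M => ∑ j ∈ Finset.range (M + 1), ((j.factorial : K)⁻¹) • wheelPow K s j M

/-- The product that is pulled back from `Ug` by the Duflo map `Duf = Sym ∘ J^(1/2)`, that is,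
`Duf⁻¹ ∘ m_U ∘ (Duf ⊗ Duf) = J^(-1/2) ∘ symProduct ∘ (J^(1/2) ⊗ J^(1/2))`. -/
noncomputable def dufloProduct (K : Type*) [Field K] : Series K 2 :=
  seriesComp K (n₁ := 0) (n₂ := 1) rfl 0 (dufloFactor K (-1))
    (seriesComp K (n₁ := 1) (n₂ := 0) rfl 0
      (seriesComp K (n₁ := 1) (n₂ := 0) rfl 1 (symProduct K) (dufloFactor K 1))
      (dufloFactor K 1))

/-- The element that encodes the differential and the commutative product. -/
noncomputable def alphaZero (K : Type*) [Field K] : Family K :=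
  strictElement K (differential K) (commProduct K)

/-- The element that encodes the differential and the product induced by the Duflo map. -/
noncomputable def alphaDuf (K : Type*) [Field K] : Family K :=
  strictElement K (differential K) (dufloProduct K)

end DufloGraph

namespace DufloGraph

/-! ### Coefficients of graphs -/

/-! The obstruction already lives in graphs with at most one internal vertex. There the IHX
relations are empty and relabelling is trivial, so coefficients of graphs are well-defined linear
forms on the quotient (`coeffAux_rel`, `coeff`). Of the Duflo product only `a₂ + (1/2) tree` is
visible, where `tree` is the bracket of the two external vertices; the wheels contribute nothing
since they start with two spokes.

Write `(n, m)` for arity `n + 1` and `m` internal vertices, and suppose `exp(ad ξ) α_Duf = α₀`. In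
`(1, 0)` the operator `ad ξ` multiplies `a₂` by a scalar, and eventual constancy of the partial sums
forces `ξ 0 0 = 0` (`eq_zero_of_gauge`). Then `ad ξ` raises `n + m`, every component of the
exponential series is a finite sum, and four equations remain:

`(2, 0)`: `[ξ 1 0, a₂] = 0`. `(3, 0)`: `[ξ 2 0, a₂] = 0`. `(1, 1)`: `[ξ 0 1, a₂] + [ξ 1 0, a₁] =
-(1/2) tree`. `(2, 1)`: `(1/2 - 1/4) [ξ 1 0, tree] + [ξ 1 1, a₂] + [ξ 2 0, a₁] = 0`, where `-1/4` is
the second order term, computed from `(1, 1)`.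

The bracket with `a₂` is a Hochschild differential, and antisymmetrized coefficients kill its
coboundaries. Hence `(1, 1)` gives `treeCoeff [ξ 1 0, a₁] = -1/2`: the edge in `ξ 1 0` has a nonzero
antisymmetric part. In `(2, 1)` the form `corollaCoeff` kills `[ξ 1 1, a₂]`
(`corollaCoeff_bracketPart_product`), it kills `[ξ 2 0, a₁]` because `ξ 2 0` is a Hochschild cocycle
(`corollaCoeff_bracketPart_differential`), and on `[ξ 1 0, tree]` it measures the same antisymmetric
part, with value `1/2` (`corollaCoeff_bracketPart_tree`). What is left is `1/8 = 0`, impossible in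
characteristic zero. -/

/-- The coordinates of a combination of edges at the edges `E j`. -/
noncomputable def coords (K : Type*) [Field K] {n m k : ℕ} (E : Fin k → Vtx n m × Vtx n m) :
    EdgeSpace K n m →ₗ[K] (Fin k → K) :=
  LinearMap.pi fun j => Finsupp.lapply (E j)

/-- The linear form on the exterior algebra of `K ^ k` that is the determinant on products of `k`
vectors and vanishes in all other degrees. -/
noncomputable def topForm (K : Type*) [Field K] (k : ℕ) :
    ExteriorAlgebra K (Fin k → K) →ₗ[K] K :=
  ExteriorAlgebra.liftAlternating
    (Pi.single (M := fun i => (Fin k → K) [⋀^Fin i]→ₗ[K] K) k Matrix.detRowAlternating)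

/-- The coefficient of the graph with edges `E 0 < ... < E (k - 1)`. -/
noncomputable def coeffAux (K : Type*) [Field K] {n m k : ℕ} (E : Fin k → Vtx n m × Vtx n m) :
    GraphAlg K n m →ₗ[K] K :=
  topForm K k ∘ₗ (ExteriorAlgebra.map (coords K E)).toLinearMap

theorem topForm_ofFn (K : Type*) [Field K] {k : ℕ} (v : Fin k → Fin k → K) :
    topForm K k (List.ofFn fun i => ExteriorAlgebra.ι K (v i)).prod = Matrix.det (Matrix.of v) := by
  rw [← ExteriorAlgebra.ιMulti_apply, topForm, ExteriorAlgebra.liftAlternating_apply_ιMulti,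
    Pi.single_eq_same]
  rfl

theorem coeffAux_one (K : Type*) [Field K] {n m : ℕ} (E : Fin 0 → Vtx n m × Vtx n m) :
    coeffAux K E 1 = 1 := by
  have := topForm_ofFn K (k := 0) ![]
  simpa [coeffAux] using this

theorem coeffAux_two (K : Type*) [Field K] {n m : ℕ} (E : Fin 2 → Vtx n m × Vtx n m)
    (x y : EdgeSpace K n m) :
    coeffAux K E (ExteriorAlgebra.ι K x * ExteriorAlgebra.ι K y) =
      x (E 0) * y (E 1) - x (E 1) * y (E 0) := by
  have := topForm_ofFn K ![coords K E x, coords K E y]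
  simpa [coeffAux, Matrix.det_fin_two, coords] using this

theorem coeffAux_three (K : Type*) [Field K] {n m : ℕ} (E : Fin 3 → Vtx n m × Vtx n m)
    (x y z : EdgeSpace K n m) :
    coeffAux K E (ExteriorAlgebra.ι K x * ExteriorAlgebra.ι K y * ExteriorAlgebra.ι K z) =
      x (E 0) * y (E 1) * z (E 2) - x (E 0) * y (E 2) * z (E 1) - x (E 1) * y (E 0) * z (E 2) +
        x (E 1) * y (E 2) * z (E 0) + x (E 2) * y (E 0) * z (E 1) - x (E 2) * y (E 1) * z (E 0) := by
  have := topForm_ofFn K ![coords K E x, coords K E y, coords K E z]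
  simpa [coeffAux, Matrix.det_fin_three, coords, mul_assoc] using this

/-! ### Coefficient forms modulo the relations. -/

/-- The graph with edges `E` has no loop, no internal vertex with two incoming edges, and no internal
vertex with three outgoing edges. -/
def Local {n m k : ℕ} (E : Fin k → Vtx n m × Vtx n m) : Prop :=
  (∀ j, (E j).1 ≠ (E j).2) ∧
  (∀ v : Fin m, ∀ j j', (E j).2 = Sum.inr v → (E j').2 = Sum.inr v → E j = E j') ∧
  (∀ v : Fin m, ∀ i j l, (E i).1 = Sum.inr v → (E j).1 = Sum.inr v → (E l).1 = Sum.inr v →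
    E i = E j ∨ E i = E l ∨ E j = E l)

instance {n m k : ℕ} (E : Fin k → Vtx n m × Vtx n m) : Decidable (Local E) := by
  have h₁ : Decidable (∀ j, (E j).1 ≠ (E j).2) := inferInstance
  have h₂ : Decidable (∀ v : Fin m, ∀ j j', (E j).2 = Sum.inr v → (E j').2 = Sum.inr v →
    E j = E j') := inferInstance
  have h₃ : Decidable (∀ v : Fin m, ∀ i j l, (E i).1 = Sum.inr v → (E j).1 = Sum.inr v →
    (E l).1 = Sum.inr v → E i = E j ∨ E i = E l ∨ E j = E l) := inferInstance
  exact instDecidableAnd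

theorem map_coords_edge (K : Type*) [Field K] {n m k : ℕ} (E : Fin k → Vtx n m × Vtx n m)
    (a b : Vtx n m) :
    ExteriorAlgebra.map (coords K E) (edge K a b) =
      ExteriorAlgebra.ι K (fun j => if (a, b) = E j then 1 else 0) := by
  rw [edge, ExteriorAlgebra.map_apply_ι]
  congr 1
  funext j
  simp [coords, Finsupp.single_apply]

theorem map_coords_edge_eq_zero (K : Type*) [Field K] {n m k : ℕ}
    {E : Fin k → Vtx n m × Vtx n m} {a b : Vtx n m} (h : ∀ j, (a, b) ≠ E j) :
    ExteriorAlgebra.map (coords K E) (edge K a b) = 0 := by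
  have : (fun j => if (a, b) = E j then (1 : K) else 0) = 0 := funext fun j => if_neg (h j)
  rw [map_coords_edge, this, map_zero]

/-- Reconnecting along the identity only deletes simple loops, and the coordinates at a loop-free
`E` do not see loops. -/
theorem reconnect_id_map_coords (K : Type*) [Field K] {n m k : ℕ}
    {E : Fin k → Vtx n m × Vtx n m} (hE : Local E) (x : GraphAlg K n m) :
    ExteriorAlgebra.map (coords K E) (reconnect K (fun a => {a}) x) =
      ExteriorAlgebra.map (coords K E) x := by
  have : (ExteriorAlgebra.map (coords K E)).comp (reconnect K (fun a => {a})) =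
      ExteriorAlgebra.map (coords K E) := by
    apply ExteriorAlgebra.hom_ext
    apply Finsupp.lhom_ext'
    rintro ⟨a, b⟩
    apply LinearMap.ext_ring
    change ExteriorAlgebra.map (coords K E) (reconnect K _ (edge K a b)) =
      ExteriorAlgebra.map (coords K E) (edge K a b)
    rw [reconnect_edge]
    split_ifs with h
    · subst h
      rw [map_zero, map_coords_edge_eq_zero]
      exact fun j hj => hE.1 j (by rw [← hj])
    · simp
  exact DFunLike.congr_fun this x

theorem edge_mul_self (K : Type*) [Field K] {n m : ℕ} (a b : Vtx n m) :
    edge K a b * edge K a b = 0 := ExteriorAlgebra.ι_sq_zero _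

theorem edge_mul_swap (K : Type*) [Field K] {n m : ℕ} (a b c d : Vtx n m) :
    edge K a b * edge K c d = -(edge K c d * edge K a b) :=
  eq_neg_of_add_eq_zero_left (ExteriorAlgebra.ι_add_mul_swap _ _)

/-- The coordinate map kills every edge outside `E`. By `Local`, the edges named in an incoming or
outgoing relation can all lie in `E` only if two of them coincide, and then their product is zero.
With at most one internal vertex the only relabelling is the identity, and an IHX relation would
need a vertex to split and hence two internal vertices afterwards. -/
theorem coeffAux_rel (K : Type*) [Field K] {n m k : ℕ} (hm : m ≤ 1)
    {E : Fin k → Vtx n m × Vtx n m} (hE : Local E) {x : GraphAlg K n m} (hx : Rel K n m x) :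
    coeffAux K E x = 0 := by
  suffices ExteriorAlgebra.map (coords K E) x = 0 by
    rw [coeffAux, LinearMap.comp_apply, AlgHom.toLinearMap_apply, this, map_zero]
  cases hx with
  | loop x y a =>
    have := map_coords_edge_eq_zero K (E := E) (a := a) (b := a)
      fun j hj => hE.1 j (by rw [← hj])
    rw [map_mul, map_mul, this, mul_zero, zero_mul]
  | incoming x y v a b =>
    suffices ExteriorAlgebra.map (coords K E) (edge K a (Sum.inr v) * edge K b (Sum.inr v)) = 0 by
      rw [map_mul, map_mul, this, mul_zero, zero_mul]
    by_cases h : ∃ j, (a, Sum.inr v) = E j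
    · by_cases h' : ∃ j, (b, Sum.inr v) = E j
      · obtain ⟨j, hj⟩ := h
        obtain ⟨j', hj'⟩ := h'
        have := hE.2.1 v j j' (by rw [← hj]) (by rw [← hj'])
        rw [← hj, ← hj'] at this
        cases this
        rw [edge_mul_self, map_zero]
      · push Not at h'
        rw [map_mul, map_coords_edge_eq_zero K h', mul_zero]
    · push Not at h
      rw [map_mul, map_coords_edge_eq_zero K h, zero_mul]
  | outgoing x y v a b c =>
    suffices ExteriorAlgebra.map (coords K E)
        (edge K (Sum.inr v) a * edge K (Sum.inr v) b * edge K (Sum.inr v) c) = 0 by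
      rw [map_mul, map_mul, this, mul_zero, zero_mul]
    by_cases h : ∃ j, (Sum.inr v, a) = E j
    · by_cases h' : ∃ j, (Sum.inr v, b) = E j
      · by_cases h'' : ∃ j, (Sum.inr v, c) = E j
        · obtain ⟨j, hj⟩ := h
          obtain ⟨j', hj'⟩ := h'
          obtain ⟨j'', hj''⟩ := h''
          have := hE.2.2 v j j' j'' (by rw [← hj]) (by rw [← hj']) (by rw [← hj''])
          rw [← hj, ← hj', ← hj''] at this
          rcases this with h | h | h <;> cases h
          · rw [edge_mul_self, zero_mul, map_zero]
          · rw [edge_mul_swap, neg_mul, mul_assoc, edge_mul_self, mul_zero, neg_zero, map_zero]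
          · rw [mul_assoc, edge_mul_self, mul_zero, map_zero]
        · push Not at h''
          rw [map_mul, map_coords_edge_eq_zero K h'', mul_zero]
      · push Not at h'
        rw [map_mul, map_mul, map_coords_edge_eq_zero K h', mul_zero, zero_mul]
    · push Not at h
      rw [map_mul, map_mul, map_coords_edge_eq_zero K h, zero_mul, zero_mul]
  | relabel x σ =>
    have : Subsingleton (Fin m) := Fin.subsingleton_iff_le_one.2 hm
    obtain rfl : σ = 1 := Subsingleton.elim _ _
    have : (fun a : Vtx n m => ({Sum.map id (1 : Equiv.Perm (Fin m)) a} : Finset (Vtx n m))) =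
        fun a => {a} := by
      funext a
      rcases a with a | a <;> rfl
    rw [this, map_sub, reconnect_id_map_coords K hE, sub_self]
  | ihx x w v => exact absurd v.2 (by omega)

/-- The coefficient of the graph with edges `E 0 < ... < E (k - 1)` as a linear form on graphs modulo
relations, in the absence of IHX relations. -/
noncomputable def coeff (K : Type*) [Field K] {n m k : ℕ} (hm : m ≤ 1)
    (E : Fin k → Vtx n m × Vtx n m) (hE : Local E) : GraphQuot K n m →ₗ[K] K :=
  (relations K n m).liftQ (coeffAux K E) (Submodule.span_le.2 fun _ hx => coeffAux_rel K hm hE hx)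

theorem coeff_mk (K : Type*) [Field K] {n m k : ℕ} (hm : m ≤ 1)
    (E : Fin k → Vtx n m × Vtx n m) (hE : Local E) (x : GraphAlg K n m) :
    coeff K hm E hE (Submodule.Quotient.mk x) = coeffAux K E x := rfl

/-! ### Coefficients of compositions as integer determinants. -/

/-- The coefficient of the edge `E` in the sum of edges obtained from `e` by reconnecting. -/
def entry {n m n' m' : ℕ} (f : Vtx n m → Finset (Vtx n' m')) (e : Vtx n m × Vtx n m)
    (E : Vtx n' m' × Vtx n' m') : ℤ :=
  if e.1 ≠ e.2 ∧ E.1 ∈ f e.1 ∧ E.2 ∈ f e.2 then 1 else 0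

theorem reconnectEdge_single_apply (K : Type*) [Field K] {n m n' m' : ℕ}
    (f : Vtx n m → Finset (Vtx n' m')) (e : Vtx n m × Vtx n m) (E : Vtx n' m' × Vtx n' m') :
    reconnectEdge K f (Finsupp.single e 1) E = entry f e E := by
  rw [reconnectEdge, Finsupp.linearCombination_single, one_smul]
  by_cases h : e.1 = e.2
  · simp [h, entry]
  · rw [if_neg h, ← Finset.sum_product']
    rw [Finsupp.finsetSum_apply]
    simp only [Finsupp.single_apply]
    rw [Finset.sum_ite_eq' (f e.1 ×ˢ f e.2) E]
    simp [entry, h]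

theorem reconnect_edge_eq (K : Type*) [Field K] {n m n' m' : ℕ}
    (f : Vtx n m → Finset (Vtx n' m')) (a b : Vtx n m) :
    reconnect K f (edge K a b) =
      ExteriorAlgebra.ι K (reconnectEdge K f (Finsupp.single (a, b) 1)) :=
  ExteriorAlgebra.map_apply_ι _ _

/-- The determinant with rows `u`, `v`. -/
def det₂ (u v : Fin 2 → ℤ) : ℤ := u 0 * v 1 - u 1 * v 0

/-- The determinant with rows `u`, `v`, `w`. -/
def det₃ (u v w : Fin 3 → ℤ) : ℤ :=
  u 0 * v 1 * w 2 - u 0 * v 2 * w 1 - u 1 * v 0 * w 2 + u 1 * v 2 * w 0 + u 2 * v 0 * w 1 -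
    u 2 * v 1 * w 0

/-- The value is the cast of an integer that depends only on finite data, so identities between such
coefficients can be decided over `ℤ` for all choices of edges at once. Separate maps `f₁`, `f₂` are
allowed because in a composition the outer and the inserted edges are reconnected differently. -/
theorem coeffAux_reconnect_two (K : Type*) [Field K] {n m n₁ m₁ n₂ m₂ : ℕ}
    (E : Fin 2 → Vtx n m × Vtx n m) (f₁ : Vtx n₁ m₁ → Finset (Vtx n m))
    (f₂ : Vtx n₂ m₂ → Finset (Vtx n m)) (a₁ b₁ : Vtx n₁ m₁) (a₂ b₂ : Vtx n₂ m₂) :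
    coeffAux K E (reconnect K f₁ (edge K a₁ b₁) * reconnect K f₂ (edge K a₂ b₂)) =
      (det₂ (fun j => entry f₁ (a₁, b₁) (E j)) (fun j => entry f₂ (a₂, b₂) (E j)) : ℤ) := by
  simp only [reconnect_edge_eq, coeffAux_two, reconnectEdge_single_apply, det₂]
  push_cast
  ring

theorem coeffAux_reconnect_three (K : Type*) [Field K] {n m n₁ m₁ n₂ m₂ n₃ m₃ : ℕ}
    (E : Fin 3 → Vtx n m × Vtx n m) (f₁ : Vtx n₁ m₁ → Finset (Vtx n m))
    (f₂ : Vtx n₂ m₂ → Finset (Vtx n m)) (f₃ : Vtx n₃ m₃ → Finset (Vtx n m))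
    (a₁ b₁ : Vtx n₁ m₁) (a₂ b₂ : Vtx n₂ m₂) (a₃ b₃ : Vtx n₃ m₃) :
    coeffAux K E (reconnect K f₁ (edge K a₁ b₁) * reconnect K f₂ (edge K a₂ b₂) *
      reconnect K f₃ (edge K a₃ b₃)) =
      (det₃ (fun j => entry f₁ (a₁, b₁) (E j)) (fun j => entry f₂ (a₂, b₂) (E j))
        (fun j => entry f₃ (a₃, b₃) (E j)) : ℤ) := by
  simp only [reconnect_edge_eq, coeffAux_three, reconnectEdge_single_apply, det₃]
  push_cast
  ring

/-! ### Homogeneous components of the bracket -/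

/-- The contribution of the components of given arities and numbers of internal vertices to the
pre-Lie product with right factor of degree `q`. -/
noncomputable def preLiePart (K : Type*) [Field K] (q : ℤ) {n₁ n₂ m₁ m₂ N M : ℕ}
    (hN : n₁ + n₂ = N) (hM : m₁ + m₂ = M) :
    GraphQuot K (n₁ + 1) m₁ →ₗ[K] GraphQuot K (n₂ + 1) m₂ →ₗ[K] GraphQuot K (N + 1) M :=
  ∑ i : Fin (n₁ + 1),
    ((-1 : K) ^ ((q - n₂) * (1 - ((n₁ : ℤ) + 1)) + (((i : ℤ) + 1) + 1) * n₂)) • comp K hN hM i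

/-- The contribution of the components of given arities and numbers of internal vertices to the
bracket of an element of degree zero and an element of degree one. -/
noncomputable def bracketPart (K : Type*) [Field K] {n₁ n₂ m₁ m₂ N M : ℕ}
    (hN : n₁ + n₂ = N) (hM : m₁ + m₂ = M) :
    GraphQuot K (n₁ + 1) m₁ →ₗ[K] GraphQuot K (n₂ + 1) m₂ →ₗ[K] GraphQuot K (N + 1) M :=
  preLiePart K 1 hN hM -
    (preLiePart K 0 ((Nat.add_comm n₂ n₁).trans hN) ((Nat.add_comm m₂ m₁).trans hM)).flip

/-! ### Reindexing the sums in the bracket. -/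

theorem sum_antidiagonal_coe {A : Type*} [AddCommMonoid A] (N : ℕ)
    (F : Finset.HasAntidiagonal.antidiagonal N → A) :
    ∑ p, F p = ∑ k : Fin (N + 1),
      F ⟨(k, N - k), Finset.HasAntidiagonal.mem_antidiagonal.2 (by simp; omega)⟩ := by
  refine (Fintype.sum_bijective (fun k : Fin (N + 1) => (⟨(k, N - k),
    Finset.HasAntidiagonal.mem_antidiagonal.2 (by simp; omega)⟩ :
      Finset.HasAntidiagonal.antidiagonal N)) ⟨fun k l h => ?_, fun p => ?_⟩ _ _ fun _ => rfl).symm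
  · simpa [Fin.ext_iff] using congrArg (fun p => p.1.1) h
  · have := Finset.HasAntidiagonal.mem_antidiagonal.1 p.2
    exact ⟨⟨p.1.1, by omega⟩, Subtype.ext (Prod.ext rfl (by simp; omega))⟩

theorem swap_mem_antidiagonal {N : ℕ} (p : Finset.HasAntidiagonal.antidiagonal N) :
    p.1.swap ∈ Finset.HasAntidiagonal.antidiagonal N :=
  Finset.HasAntidiagonal.mem_antidiagonal.2
    ((Nat.add_comm _ _).trans (Finset.HasAntidiagonal.mem_antidiagonal.1 p.2))

theorem sum_antidiagonal_swap {A : Type*} [AddCommMonoid A] (N : ℕ)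
    (F : Finset.HasAntidiagonal.antidiagonal N → A) :
    ∑ p, F p = ∑ p : Finset.HasAntidiagonal.antidiagonal N,
      F ⟨p.1.swap, swap_mem_antidiagonal p⟩ :=
  (Fintype.sum_bijective (fun p : Finset.HasAntidiagonal.antidiagonal N =>
    (⟨p.1.swap, swap_mem_antidiagonal p⟩ : Finset.HasAntidiagonal.antidiagonal N))
    (Function.Involutive.bijective fun _ => rfl) _ _ fun _ => rfl).symm

theorem preLieMul_apply (K : Type*) [Field K] (q : ℤ) (x y : Family K) (N M : ℕ) :
    preLieMul K q x y N M = ∑ p : Finset.HasAntidiagonal.antidiagonal N,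
      ∑ r : Finset.HasAntidiagonal.antidiagonal M,
        preLiePart K q (Finset.HasAntidiagonal.mem_antidiagonal.1 p.2)
          (Finset.HasAntidiagonal.mem_antidiagonal.1 r.2) (x p.1.1 r.1.1) (y p.1.2 r.1.2) := by
  unfold preLieMul
  refine Finset.sum_congr rfl fun p _ => ?_
  simp only [preLiePart, LinearMap.sum_apply, LinearMap.smul_apply, seriesComp, Finset.smul_sum]
  rw [Finset.sum_comm]

/-- In degrees `0` and `1` the commutator sign is `+1`; swapping both antidiagonals in the product
`y ⋆ x` pairs the same components of `x` and `y` in both halves. -/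
theorem bracket_apply_antidiagonal (K : Type*) [Field K] (x y : Family K) (N M : ℕ) :
    bracket K 0 1 x y N M = ∑ p : Finset.HasAntidiagonal.antidiagonal N,
      ∑ r : Finset.HasAntidiagonal.antidiagonal M,
        bracketPart K (Finset.HasAntidiagonal.mem_antidiagonal.1 p.2)
          (Finset.HasAntidiagonal.mem_antidiagonal.1 r.2) (x p.1.1 r.1.1) (y p.1.2 r.1.2) := by
  have h : bracket K 0 1 x y N M = preLieMul K 1 x y N M - preLieMul K 0 y x N M := by
    simp [bracket]
  rw [h, preLieMul_apply, preLieMul_apply,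
    sum_antidiagonal_swap N fun p => ∑ r : Finset.HasAntidiagonal.antidiagonal M, preLiePart K 0
      (Finset.HasAntidiagonal.mem_antidiagonal.1 p.2) (Finset.HasAntidiagonal.mem_antidiagonal.1 r.2)
      (y p.1.1 r.1.1) (x p.1.2 r.1.2), ← Finset.sum_sub_distrib]
  refine Finset.sum_congr rfl fun p _ => ?_
  rw [sum_antidiagonal_swap M fun r => preLiePart K 0 _
      (Finset.HasAntidiagonal.mem_antidiagonal.1 r.2) (y _ r.1.1) (x _ r.1.2),
    ← Finset.sum_sub_distrib]
  rfl

theorem bracket_apply (K : Type*) [Field K] (x y : Family K) (N M : ℕ) :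
    bracket K 0 1 x y N M = ∑ k : Fin (N + 1), ∑ l : Fin (M + 1),
        bracketPart K (n₁ := k) (n₂ := N - k) (m₁ := l) (m₂ := M - l) (by omega) (by omega)
          (x k l) (y (N - k) (M - l)) := by
  rw [bracket_apply_antidiagonal, sum_antidiagonal_coe]
  refine Finset.sum_congr rfl fun p _ => ?_
  rw [sum_antidiagonal_coe]

/-! ### Components of the Duflo product -/

/-- The tree that represents the bracket of the two external vertices. -/
noncomputable def tree (K : Type*) [Field K] : GraphAlg K 2 1 :=
  edge K (Sum.inr 0) (Sum.inl 0) * edge K (Sum.inr 0) (Sum.inl 1)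

/-- The words `XY` and `YX` have coefficients `1/2` and `-1/2`, which Dynkin's formula divides by
the word length `2`; exchanging the two edges of the tree changes its sign, so both words contribute
`1/4`. The words `XX` and `YY` give double edges. -/
theorem bchTrees_one (K : Type*) [Field K] [CharZero K] :
    bchTrees K 1 = (1 / 2 : K) • tree K := by
  have h₀ : bchCoeff [0, 1] = 1 / 2 := by decide +kernel
  have h₁ : bchCoeff [1, 0] = -1 / 2 := by decide +kernel
  have h : ∀ w : Fin 2 → Fin 2, bracketTree K w =
      edge K (Sum.inr 0) (Sum.inl (w 0)) * edge K (Sum.inr 0) (Sum.inl (w 1)) := fun w => by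
    simp [bracketTree, graph, List.finRange_succ]
  rw [bchTrees, if_neg one_ne_zero, ← (finTwoArrowEquiv (Fin 2)).symm.sum_comp,
    Fintype.sum_prod_type]
  simp only [h, Fin.sum_univ_two, finTwoArrowEquiv_symm_apply,
    Matrix.cons_val_zero,
    Matrix.cons_val_one, edge_mul_self, smul_zero, List.ofFn_succ, List.ofFn_zero, Fin.succ_zero_eq_one,
    h₀, h₁, tree, zero_add, add_zero]
  rw [edge_mul_swap K (Sum.inr 0) (Sum.inl 1), smul_neg, ← neg_smul, ← add_smul]
  congr 1
  push_cast
  norm_num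

/-! ### Compositions of series up to one internal vertex. -/

theorem seriesComp_zero (K : Type*) [Field K] {n₁ n₂ N : ℕ} (hN : n₁ + n₂ = N)
    (i : Fin (n₁ + 1)) (x : Series K (n₁ + 1)) (y : Series K (n₂ + 1)) :
    seriesComp K hN i x y 0 = comp K hN rfl i (x 0) (y 0) := by
  rw [seriesComp, sum_antidiagonal_coe, Fin.sum_univ_one]
  rfl

theorem seriesComp_one (K : Type*) [Field K] {n₁ n₂ N : ℕ} (hN : n₁ + n₂ = N)
    (i : Fin (n₁ + 1)) (x : Series K (n₁ + 1)) (y : Series K (n₂ + 1)) :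
    seriesComp K hN i x y 1 =
      comp K hN rfl i (x 0) (y 1) + comp K hN rfl i (x 1) (y 0) := by
  rw [seriesComp, sum_antidiagonal_coe, Fin.sum_univ_two]
  rfl

theorem symProduct_zero (K : Type*) [Field K] : symProduct K 0 = Submodule.Quotient.mk 1 := by
  simp [symProduct, bchPow]

theorem symProduct_one (K : Type*) [Field K] [CharZero K] :
    symProduct K 1 = (1 / 2 : K) • Submodule.Quotient.mk (tree K) := by
  have h : bchPow K 1 1 = (1 / 2 : K) • tree K := by
    rw [bchPow, sum_antidiagonal_coe]
    simp only [bchPow]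
    simp [superpose, bchTrees_one, tree, reconnect_edge]
  rw [symProduct, Finset.sum_range_succ, Finset.sum_range_one, h]
  simp [bchPow]

theorem dufloFactor_zero (K : Type*) [Field K] (s : ℚ) :
    dufloFactor K s 0 = Submodule.Quotient.mk 1 := by
  simp [dufloFactor, wheelPow]

/-- The wheels start with two internal vertices. Hence the Duflo correction does not affect the
product up to one internal vertex. -/
theorem dufloFactor_one (K : Type*) [Field K] (s : ℚ) : dufloFactor K s 1 = 0 := by
  rw [dufloFactor, Finset.sum_range_succ, Finset.sum_range_one, wheelPow, wheelPow, seriesComp_one]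
  simp [wheelSeries]

theorem comp_one_one (K : Type*) [Field K] {n₁ n₂ m₁ m₂ N M : ℕ} (hN : n₁ + n₂ = N)
    (hM : m₁ + m₂ = M) (i : Fin (n₁ + 1)) :
    comp K hN hM i (Submodule.Quotient.mk 1) (Submodule.Quotient.mk 1) =
      Submodule.Quotient.mk 1 := by
  rw [comp_mk, map_one, map_one, mul_one]

theorem comp_tree_one (K : Type*) [Field K] (i : Fin 2) :
    comp K (n₁ := 1) (n₂ := 0) (m₁ := 1) (m₂ := 0) (N := 1) (M := 1) rfl rfl i
      (Submodule.Quotient.mk (tree K))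
      (Submodule.Quotient.mk 1) = Submodule.Quotient.mk (tree K) := by
  have h : outerVtx (n₁ := 1) (n₂ := 0) (m₁ := 1) (m₂ := 0) (N := 1) (M := 1) rfl rfl i =
      fun a => {a} := by
    funext a
    revert i a
    decide
  rw [comp_mk, map_one, mul_one, h]
  simp [tree, reconnect_edge]

theorem comp_one_tree (K : Type*) [Field K] :
    comp K (n₁ := 0) (n₂ := 1) (m₁ := 0) (m₂ := 1) (N := 1) (M := 1) rfl rfl 0 (Submodule.Quotient.mk 1)
      (Submodule.Quotient.mk (tree K)) = Submodule.Quotient.mk (tree K) := by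
  rw [comp_mk, map_one, one_mul]
  simp [tree, reconnect_edge, innerVtx]

theorem dufloProduct_zero (K : Type*) [Field K] : dufloProduct K 0 = Submodule.Quotient.mk 1 := by
  simp only [dufloProduct, seriesComp_zero, dufloFactor_zero, symProduct_zero, comp_one_one]

theorem dufloProduct_one (K : Type*) [Field K] [CharZero K] :
    dufloProduct K 1 = (1 / 2 : K) • Submodule.Quotient.mk (tree K) := by
  simp only [dufloProduct, seriesComp_zero, seriesComp_one, dufloFactor_zero, dufloFactor_one,
    symProduct_zero, symProduct_one, comp_one_one, map_smul, map_zero, zero_add, add_zero,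
    LinearMap.zero_apply, LinearMap.smul_apply]
  rw [comp_tree_one, comp_tree_one, comp_one_tree]

/-! ### Low components of a gauge transformation -/

theorem bracket_zero_zero (K : Type*) [Field K] (x y : Family K) :
    bracket K 0 1 x y 0 0 = bracketPart K rfl rfl (x 0 0) (y 0 0) := by
  simp [bracket_apply]

theorem bracket_one_zero (K : Type*) [Field K] (x y : Family K) :
    bracket K 0 1 x y 1 0 = bracketPart K rfl rfl (x 0 0) (y 1 0) +
      bracketPart K rfl rfl (x 1 0) (y 0 0) := by
  simp [bracket_apply, Fin.sum_univ_succ]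

/-- When both components at `(0, 0)` vanish, only decompositions of the bidegree into two nonzero
bidegrees contribute. This is the source of the nilpotence of `ad ξ` in each component. -/
theorem bracket_two_zero {K : Type*} [Field K] {x y : Family K} (hx : x 0 0 = 0)
    (hy : y 0 0 = 0) :
    bracket K 0 1 x y 2 0 = bracketPart K rfl rfl (x 1 0) (y 1 0) := by
  simp [bracket_apply, Fin.sum_univ_succ, hx, hy]

theorem bracket_three_zero {K : Type*} [Field K] {x y : Family K} (hx : x 0 0 = 0)
    (hy : y 0 0 = 0) :
    bracket K 0 1 x y 3 0 = bracketPart K rfl rfl (x 1 0) (y 2 0) +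
      bracketPart K rfl rfl (x 2 0) (y 1 0) := by
  simp [bracket_apply, Fin.sum_univ_succ, hx, hy]

theorem bracket_zero_one {K : Type*} [Field K] {x y : Family K} (hx : x 0 0 = 0)
    (hy : y 0 0 = 0) : bracket K 0 1 x y 0 1 = 0 := by
  simp [bracket_apply, Fin.sum_univ_succ, hx, hy]

theorem bracket_one_one {K : Type*} [Field K] {x y : Family K} (hx : x 0 0 = 0)
    (hy : y 0 0 = 0) :
    bracket K 0 1 x y 1 1 = bracketPart K rfl rfl (x 0 1) (y 1 0) +
      bracketPart K rfl rfl (x 1 0) (y 0 1) := by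
  simp [bracket_apply, Fin.sum_univ_succ, hx, hy]

theorem bracket_two_one {K : Type*} [Field K] {x y : Family K} (hx : x 0 0 = 0)
    (hy : y 0 0 = 0) :
    bracket K 0 1 x y 2 1 = bracketPart K rfl rfl (x 0 1) (y 2 0) +
      (bracketPart K rfl rfl (x 1 0) (y 1 1) + bracketPart K rfl rfl (x 1 1) (y 1 0) +
        bracketPart K rfl rfl (x 2 0) (y 0 1)) := by
  simp [bracket_apply, Fin.sum_univ_succ, hx, hy, add_assoc]

/-! ### The obstruction -/

/-- The degree fixes the number of edges, so an identity of linear forms on `dgraphs` reduces to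
finitely many edge lists. -/
theorem eqOn_dgraphs {K : Type*} [Field K] {n m : ℕ} {d : ℤ} {F G : GraphQuot K n m →ₗ[K] K}
    (h : ∀ l : List (Vtx n m × Vtx n m), 2 * (m : ℤ) - (l.length : ℤ) = d →
      F (Submodule.Quotient.mk (graph K l)) = G (Submodule.Quotient.mk (graph K l)))
    {x : GraphQuot K n m} (hx : x ∈ dgraphs K n m d) : F x = G x := by
  refine LinearMap.eqOn_span ?_ hx
  rintro _ ⟨l, _, hd, rfl⟩
  exact h l hd

/-- The edge from the `j`-th external vertex to the internal vertex. -/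
abbrev inEdge {n : ℕ} (j : Fin n) : Vtx n 1 × Vtx n 1 := (Sum.inl j, Sum.inr 0)

/-- The edge from the internal vertex to the `j`-th external vertex. -/
abbrev outEdge {n : ℕ} (j : Fin n) : Vtx n 1 × Vtx n 1 := (Sum.inr 0, Sum.inl j)

/-- The coefficient of the bracket of two external vertices. -/
noncomputable def treeCoeff (K : Type*) [Field K] : GraphQuot K 2 1 →ₗ[K] K :=
  coeff K le_rfl ![outEdge 0, outEdge 1] (by decide)

/-- The antisymmetrized coefficient of the corolla with one incoming edge and two outgoing edges. -/
noncomputable def corollaCoeff (K : Type*) [Field K] : GraphQuot K 3 1 →ₗ[K] K :=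
  coeff K le_rfl ![inEdge 0, outEdge 1, outEdge 2] (by decide) +
    coeff K le_rfl ![inEdge 1, outEdge 2, outEdge 0] (by decide) +
    coeff K le_rfl ![inEdge 2, outEdge 0, outEdge 1] (by decide)

/-- The coefficient of the graph with edges `a → b` and `c → d` between external vertices. -/
noncomputable def pairCoeff (K : Type*) [Field K] {n : ℕ} (a b c d : Fin n) (h : a ≠ b ∧ c ≠ d) :
    GraphQuot K n 0 →ₗ[K] K :=
  coeff K zero_le_one ![(Sum.inl a, Sum.inl b), (Sum.inl c, Sum.inl d)]
    ⟨by simpa [Fin.forall_fin_two] using h, fun v => v.elim0, fun v => v.elim0⟩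

theorem pairCoeff_mk (K : Type*) [Field K] {n : ℕ} (a b c d : Fin n) (h : a ≠ b ∧ c ≠ d)
    (x : GraphAlg K n 0) : pairCoeff K a b c d h (Submodule.Quotient.mk x) =
      coeffAux K ![(Sum.inl a, Sum.inl b), (Sum.inl c, Sum.inl d)] x := rfl

/-! ### Values of the coefficient forms on brackets. -/

theorem treeCoeff_tree (K : Type*) [Field K] :
    treeCoeff K (Submodule.Quotient.mk (tree K)) = 1 := by
  rw [treeCoeff, coeff_mk, tree, edge, edge, coeffAux_two]
  simp

/-- The bracket of `x` with the commutative product is symmetric in the two external vertices, while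
the tree is antisymmetric. -/
theorem treeCoeff_bracketPart_product (K : Type*) [Field K] [CharZero K] {x : GraphQuot K 1 1}
    (hx : x ∈ dgraphs K 1 1 0) :
    treeCoeff K (bracketPart K (n₁ := 0) (n₂ := 1) (m₁ := 1) (m₂ := 0) rfl rfl x
      (Submodule.Quotient.mk 1)) = 0 := by
  refine eqOn_dgraphs (F := treeCoeff K ∘ₗ (bracketPart K (n₁ := 0) (n₂ := 1) (m₁ := 1) (m₂ := 0)
    rfl rfl).flip (Submodule.Quotient.mk 1)) (G := 0) (fun l hl => ?_) hx
  obtain ⟨⟨a, b⟩, ⟨c, d⟩, rfl⟩ := List.length_eq_two.1 (by omega : l.length = 2)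
  simp [bracketPart, preLiePart, comp_mk, graph, treeCoeff, coeff_mk, coeffAux_reconnect_two,
    Fin.sum_univ_succ]
  norm_cast
  clear hl
  revert a b c d
  decide +kernel

/-- If `0 → 1` and `1 → 0` have coefficients `p` and `q` in `x`, then `treeCoeff` of the bracket
with the differential is `p - q`: the tree arises when the source of the edge moves to the internal
vertex. The corolla arises when the target moves to the internal vertex of the inserted tree, with
total coefficient `q - p`. -/
theorem corollaCoeff_bracketPart_tree (K : Type*) [Field K] [CharZero K] {x : GraphQuot K 2 0}
    (hx : x ∈ dgraphs K 2 0 (-1)) :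
    corollaCoeff K (bracketPart K (n₁ := 1) (n₂ := 1) (m₁ := 0) (m₂ := 1) rfl rfl x
      (Submodule.Quotient.mk (tree K))) =
    -treeCoeff K (bracketPart K (n₁ := 1) (n₂ := 0) (m₁ := 0) (m₂ := 1) rfl rfl x
      (differential K 1)) := by
  let F : GraphQuot K 2 0 →ₗ[K] K := corollaCoeff K ∘ₗ
    (bracketPart K (n₁ := 1) (n₂ := 1) (m₁ := 0) (m₂ := 1) (N := 2) (M := 1) rfl rfl).flip
      (Submodule.Quotient.mk (tree K))
  let G : GraphQuot K 2 0 →ₗ[K] K := -(treeCoeff K ∘ₗ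
    (bracketPart K (n₁ := 1) (n₂ := 0) (m₁ := 0) (m₂ := 1) (N := 1) (M := 1) rfl rfl).flip
      (differential K 1))
  have h : F x = G x := eqOn_dgraphs (fun l hl => ?_) hx
  · exact h
  obtain ⟨⟨a, b⟩, rfl⟩ := List.length_eq_one_iff.1 (by omega : l.length = 1)
  clear hl
  have hd : differential K 1 = Submodule.Quotient.mk
    (edge K (Sum.inr 0) (Sum.inl 0) + edge K (Sum.inl 0) (Sum.inr 0)) := rfl
  simp only [F, G, hd]
  simp [bracketPart, preLiePart, comp_mk, graph, tree, Fin.sum_univ_succ, ← mul_assoc]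
  simp [corollaCoeff, treeCoeff, coeff_mk, -Matrix.cons_val]
  simp only [coeffAux_reconnect_three, coeffAux_reconnect_two]
  norm_cast
  revert a b
  decide +kernel

/-- Antisymmetrization kills Hochschild coboundaries: inserting the product at a vertex of `x` is
symmetric in the two new vertices, and inserting `x` into the product leaves an external vertex
isolated, whereas the corolla meets all three. -/
theorem corollaCoeff_bracketPart_product (K : Type*) [Field K] [CharZero K] {x : GraphQuot K 2 1}
    (hx : x ∈ dgraphs K 2 1 (-1)) :
    corollaCoeff K (bracketPart K (n₁ := 1) (n₂ := 1) (m₁ := 1) (m₂ := 0) rfl rfl x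
      (Submodule.Quotient.mk 1)) = 0 := by
  let F : GraphQuot K 2 1 →ₗ[K] K := corollaCoeff K ∘ₗ
    (bracketPart K (n₁ := 1) (n₂ := 1) (m₁ := 1) (m₂ := 0) (N := 2) (M := 1) rfl rfl).flip
      (Submodule.Quotient.mk 1)
  have h : F x = (0 : GraphQuot K 2 1 →ₗ[K] K) x := eqOn_dgraphs (fun l hl => ?_) hx
  · exact h
  obtain ⟨⟨a, b⟩, ⟨c, d⟩, ⟨e, f⟩, rfl⟩ := List.length_eq_three.1 (by omega : l.length = 3)
  clear hl
  let f (i : Fin 2) : Vtx 2 1 → Finset (Vtx 3 1) :=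
    outerVtx (n₁ := 1) (n₂ := 1) (m₁ := 1) (m₂ := 0) (N := 2) (M := 1) rfl rfl i
  let g (i : Fin 2) : Vtx 2 1 → Finset (Vtx 3 1) := fun a =>
    {innerVtx (n₁ := 1) (n₂ := 1) (m₁ := 0) (m₂ := 1) (N := 2) (M := 1) rfl rfl i a}
  -- The symmetry of `x ∘ᵢ a₂` in the two vertices replacing the `i`-th one: two columns in the
  -- determinants become interchangeable, and the cyclic sum cancels.
  have h₁ : ∀ e, entry (f 0) e (inEdge 1) = entry (f 0) e (inEdge 0) ∧
      entry (f 0) e (outEdge 1) = entry (f 0) e (outEdge 0) ∧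
      entry (f 1) e (inEdge 2) = entry (f 1) e (inEdge 1) ∧
      entry (f 1) e (outEdge 2) = entry (f 1) e (outEdge 1) := by decide +kernel
  -- No edge of `a₂ ∘ᵢ x` meets the remaining external vertex of `a₂`.
  have h₂ : ∀ e, entry (g 0) e (inEdge 2) = 0 ∧ entry (g 0) e (outEdge 2) = 0 ∧
      entry (g 1) e (inEdge 0) = 0 ∧ entry (g 1) e (outEdge 0) = 0 := by decide +kernel
  simp only [f] at h₁
  simp only [g] at h₂
  simp only [F]
  simp [bracketPart, preLiePart, comp_mk, graph, Fin.sum_univ_succ, ← mul_assoc]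
  simp [corollaCoeff, coeff_mk, -Matrix.cons_val]
  simp only [coeffAux_reconnect_three]
  norm_cast
  simp only [det₃, Matrix.cons_val, h₁, h₂]
  ring

/-- A corolla in the bracket of `x` with the differential comes from a connected two-edge graph in
`x`, a path or a fork. Splitting the shared vertex of such a graph, as insertion of the product
does, gives two disjoint edges on four vertices. The relevant combination of coefficients of `x` can
therefore be read off from its Hochschild coboundary, and vanishes on cocycles. -/
theorem corollaCoeff_bracketPart_differential (K : Type*) [Field K] [CharZero K]
    {x : GraphQuot K 3 0} (hx : x ∈ dgraphs K 3 0 (-2))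
    (h : bracketPart K (n₁ := 2) (n₂ := 1) (m₁ := 0) (m₂ := 0) (N := 3) (M := 0) rfl rfl x
      (Submodule.Quotient.mk 1) = 0) :
    corollaCoeff K (bracketPart K (n₁ := 2) (n₂ := 0) (m₁ := 0) (m₂ := 1) rfl rfl x
      (differential K 1)) = 0 := by
  -- An explicit form through which twice the corolla coefficient factors. Each pair of edges in it
  -- is a perfect matching of the four vertices, so inserting `x` into the product, which isolates a
  -- vertex, contributes nothing to it.
  let χ : GraphQuot K 4 0 →ₗ[K] K :=
    (2 : K) • (pairCoeff K 0 2 3 1 (by decide) + pairCoeff K 2 0 1 3 (by decide) -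
      pairCoeff K 0 1 3 2 (by decide)) + pairCoeff K 0 2 1 3 (by decide) -
      pairCoeff K 0 3 1 2 (by decide) + pairCoeff K 2 0 3 1 (by decide) +
      pairCoeff K 3 0 2 1 (by decide) + pairCoeff K 0 1 2 3 (by decide) +
      pairCoeff K 1 0 3 2 (by decide)
  let F : GraphQuot K 3 0 →ₗ[K] K := (2 : K) • corollaCoeff K ∘ₗ
    (bracketPart K (n₁ := 2) (n₂ := 0) (m₁ := 0) (m₂ := 1) (N := 2) (M := 1) rfl rfl).flip
      (differential K 1)
  let G : GraphQuot K 3 0 →ₗ[K] K := χ ∘ₗ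
    (bracketPart K (n₁ := 2) (n₂ := 1) (m₁ := 0) (m₂ := 0) (N := 3) (M := 0) rfl rfl).flip
      (Submodule.Quotient.mk 1)
  have h' : F x = G x := eqOn_dgraphs (fun l hl => ?_) hx
  · have hG : G x = 0 := by
      rw [LinearMap.comp_apply, LinearMap.flip_apply, h, map_zero]
    rw [hG] at h'
    exact (mul_eq_zero.1 h').resolve_left two_ne_zero
  obtain ⟨⟨a, b⟩, ⟨c, d⟩, rfl⟩ := List.length_eq_two.1 (by omega : l.length = 2)
  clear hl
  have hd : differential K 1 = Submodule.Quotient.mk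
    (edge K (Sum.inr 0) (Sum.inl 0) + edge K (Sum.inl 0) (Sum.inr 0)) := rfl
  simp only [F, G, hd]
  simp [bracketPart, preLiePart, comp_mk, graph, Fin.sum_univ_succ, ← mul_assoc, mul_add]
  simp [corollaCoeff, χ, coeff_mk, -Matrix.cons_val]
  simp only [pairCoeff_mk, coeffAux_reconnect_three, coeffAux_reconnect_two]
  norm_cast
  revert a b c d
  decide +kernel

/-! ### Gauge transformations -/

theorem alphaDuf_two (K : Type*) [Field K] (n m : ℕ) : alphaDuf K (n + 2) m = 0 := rfl

theorem alphaZero_two (K : Type*) [Field K] (n m : ℕ) : alphaZero K (n + 2) m = 0 := rfl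

theorem mk_one_ne_zero (K : Type*) [Field K] {n : ℕ} :
    (Submodule.Quotient.mk 1 : GraphQuot K n 0) ≠ 0 := by
  intro h
  let F : GraphQuot K n 0 →ₗ[K] K := coeff K zero_le_one (k := 0) (fun j => j.elim0)
    ⟨fun j => j.elim0, fun _ j => j.elim0, fun _ j => j.elim0⟩
  have h₁ : F (Submodule.Quotient.mk 1) = 1 := coeffAux_one K _
  rw [h, map_zero] at h₁
  exact zero_ne_one h₁

/-- Bracketing with the identity counts inputs: inserting the product into it gives the product
once, inserting it into the two inputs of the product gives it twice, and `1 - 2 = -1`. -/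
theorem bracketPart_one_product (K : Type*) [Field K] :
    bracketPart K (n₁ := 0) (n₂ := 1) (m₁ := 0) (m₂ := 0) (N := 1) (M := 0) rfl rfl
      (Submodule.Quotient.mk 1) (Submodule.Quotient.mk 1) = -Submodule.Quotient.mk 1 := by
  simp [bracketPart, preLiePart, comp_one_one, Fin.sum_univ_succ]

theorem exists_smul_one (K : Type*) [Field K] {x : GraphQuot K 1 0} (hx : x ∈ dgraphs K 1 0 0) :
    ∃ c : K, x = c • Submodule.Quotient.mk 1 := by
  have : dgraphs K 1 0 0 ≤ Submodule.span K {Submodule.Quotient.mk 1} := by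
    refine Submodule.span_le.2 ?_
    rintro _ ⟨l, _, hl, rfl⟩
    obtain rfl : l = [] := List.length_eq_zero_iff.1 (by omega)
    exact Submodule.mem_span_singleton_self _
  obtain ⟨c, hc⟩ := Submodule.mem_span_singleton.1 (this hx)
  exact ⟨c, hc.symm⟩

/-! ### The iterated brackets and their lowest components. -/

/-- The terms of the exponential series without the factorials. -/
noncomputable def adPow (K : Type*) [Field K] (ξ : Family K) (k : ℕ) : Family K :=
  (bracket K 0 1 ξ)^[k] (alphaDuf K)

theorem adPow_zero (K : Type*) [Field K] (ξ : Family K) : adPow K ξ 0 = alphaDuf K := rfl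

theorem adPow_succ (K : Type*) [Field K] (ξ : Family K) (k : ℕ) :
    adPow K ξ (k + 1) = bracket K 0 1 ξ (adPow K ξ k) :=
  Function.iterate_succ_apply' _ _ _

theorem adPow_zero_zero (K : Type*) [Field K] (ξ : Family K) (k : ℕ) : adPow K ξ k 0 0 = 0 := by
  induction k with
  | zero => rfl
  | succ k ih => rw [adPow_succ, bracket_zero_zero, ih, map_zero]

theorem adPow_one_zero (K : Type*) [Field K] {ξ : Family K} {c : K}
    (h : ξ 0 0 = c • Submodule.Quotient.mk 1) (k : ℕ) :
    adPow K ξ k 1 0 = (-c) ^ k • Submodule.Quotient.mk 1 := by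
  induction k with
  | zero => rw [pow_zero, one_smul]; exact dufloProduct_zero K
  | succ k ih =>
    rw [adPow_succ, bracket_one_zero, adPow_zero_zero, map_zero, add_zero, ih, h, map_smul,
      map_smul, LinearMap.smul_apply, bracketPart_one_product, smul_neg, smul_neg, smul_smul,
      ← neg_smul, pow_succ, mul_neg]

/-- If the exponential series of `ξ` converges, then `ξ` has no multiple of the identity in it. -/
theorem eq_zero_of_gauge (K : Type*) [Field K] [CharZero K] {ξ β : Family K}
    (hξ : ξ ∈ convolution K 0)
    (h : ∀ n m : ℕ, ∃ B : ℕ, ∀ b ≥ B,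
      (∑ k ∈ Finset.range b, ((k.factorial : K)⁻¹) • adPow K ξ k) n m = β n m) :
    ξ 0 0 = 0 := by
  obtain ⟨c, hc⟩ := exists_smul_one K (x := ξ 0 0) (by simpa using hξ 0 0)
  obtain ⟨B, hB⟩ := h 1 0
  -- The difference of these two partial sums is the term of index `B + 1`, a multiple of `(-c) ^ (B
  -- + 1)`. The exponent is positive even if `B = 0`, so its vanishing gives `c = 0`.
  have h₁ := hB (B + 1) (by omega)
  have h₂ := hB (B + 2) (by omega)
  rw [Finset.sum_range_succ, Pi.add_apply, Pi.add_apply, h₁, add_eq_left, Pi.smul_apply,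
    Pi.smul_apply, adPow_one_zero K hc, smul_smul, smul_eq_zero_iff_left (mk_one_ne_zero K),
    mul_eq_zero, inv_eq_zero, Nat.cast_eq_zero] at h₂
  have : c = 0 := by simpa [Nat.factorial_ne_zero] using h₂
  rw [hc, this, zero_smul]

theorem sum_eq_of_eventually {V : Type*} [AddCommGroup V] {u : ℕ → V} {v : V} {N : ℕ}
    (hu : ∀ k ≥ N, u k = 0) (h : ∃ B : ℕ, ∀ b ≥ B, ∑ k ∈ Finset.range b, u k = v) :
    ∑ k ∈ Finset.range N, u k = v := by
  obtain ⟨B, hB⟩ := h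
  rw [← hB (max B N) (le_max_left _ _)]
  refine Finset.sum_subset (Finset.range_mono (le_max_right _ _)) fun k _ hk => hu k ?_
  simpa using hk

set_option maxHeartbeats 1000000 in
theorem not_gauge (K : Type*) [Field K] [CharZero K] {ξ : Family K} (hξ : ξ ∈ convolution K 0)
    (h : ∀ n m : ℕ, ∃ B : ℕ, ∀ b ≥ B,
      (∑ k ∈ Finset.range b, ((k.factorial : K)⁻¹) • adPow K ξ k) n m = alphaZero K n m) :
    False := by
  have h₀ := eq_zero_of_gauge K hξ h
  -- In a component where the iterates vanish from `N` on, convergence is the equation for the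
  -- finite sum over `k < N`.
  have hs : ∀ {n m N}, (∀ k ≥ N, adPow K ξ k n m = 0) →
      ∑ k ∈ Finset.range N, ((k.factorial : K)⁻¹) • adPow K ξ k n m = alphaZero K n m := by
    intro n m N hN
    refine sum_eq_of_eventually (fun k hk => by rw [hN k hk, smul_zero]) ?_
    simpa only [Finset.sum_apply, Pi.smul_apply] using h n m
  have hz := adPow_zero_zero K ξ
  -- Since `ξ 0 0 = 0`, each application of `ad ξ` raises `n + m`, and `alphaDuf` starts at `n + m =
  -- 1`; hence the successive bounds on `k` below.
  have a10 : ∀ k, adPow K ξ (k + 1) 1 0 = 0 := fun k => by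
    rw [adPow_one_zero K (c := 0) (by rw [h₀, zero_smul])]; simp
  have a01 : ∀ k, adPow K ξ (k + 1) 0 1 = 0 := fun k => by
    rw [adPow_succ, bracket_zero_one h₀ (hz k)]
  have b10 : adPow K ξ 0 1 0 = Submodule.Quotient.mk 1 := dufloProduct_zero K
  have b11 : adPow K ξ 0 1 1 = (1 / 2 : K) • Submodule.Quotient.mk (tree K) := dufloProduct_one K
  have a20 : ∀ k, adPow K ξ (k + 2) 2 0 = 0 := fun k => by
    rw [adPow_succ, bracket_two_zero h₀ (hz _), a10, map_zero]
  -- Both elements vanish in arity three, so the only surviving term of the series, the linear one,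
  -- vanishes: `ξ 1 0` is a Hochschild cocycle.
  have c20 : adPow K ξ 1 2 0 = 0 := by
    have := hs (n := 2) (m := 0) (N := 2) fun k hk => by
      obtain ⟨k, rfl⟩ := Nat.exists_eq_add_of_le' hk
      exact a20 k
    simpa [Finset.sum_range_succ, adPow_zero, alphaDuf_two K 0, alphaZero_two K 0] using this
  have d20 : ∀ k, adPow K ξ k 2 0 = 0
    | 0 => rfl
    | 1 => c20
    | k + 2 => a20 k
  have a11 : ∀ k, adPow K ξ (k + 2) 1 1 = 0 := fun k => by
    rw [adPow_succ, bracket_one_one h₀ (hz _), a10, a01, map_zero, map_zero, add_zero]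
  -- Counting `n + m` alone allows a term with `k = 2` here; `d20` removes it, so the arity four
  -- equation is linear in `ξ 2 0`.
  have a30 : ∀ k, adPow K ξ (k + 2) 3 0 = 0 := fun k => by
    rw [adPow_succ, bracket_three_zero h₀ (hz _), a10, d20, map_zero, map_zero, add_zero]
  have a21 : ∀ k, adPow K ξ (k + 3) 2 1 = 0 := fun k => by
    rw [adPow_succ, bracket_two_one h₀ (hz _), a10, a01, a11, d20]
    simp only [map_zero, add_zero]
  have e30 : bracketPart K (n₁ := 2) (n₂ := 1) (m₁ := 0) (m₂ := 0) (N := 3) (M := 0) rfl rfl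
      (ξ 2 0) (Submodule.Quotient.mk 1) = 0 := by
    have := hs (n := 3) (m := 0) (N := 2) fun k hk => by
      obtain ⟨k, rfl⟩ := Nat.exists_eq_add_of_le' hk
      exact a30 k
    rw [Finset.sum_range_succ, Finset.sum_range_one, adPow_zero, alphaDuf_two K 1,
      alphaZero_two K 1, adPow_succ, bracket_three_zero h₀ (hz _), d20, b10] at this
    simpa using this
  set R := bracketPart K (n₁ := 1) (n₂ := 0) (m₁ := 0) (m₂ := 1) (N := 1) (M := 1) rfl rfl (ξ 1 0)
    (differential K 1) with hR
  -- The linear term must cancel the tree in the Duflo product. This value also enters the second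
  -- iterate at `(2, 1)`.
  have e11 : adPow K ξ 1 1 1 = -((1 / 2 : K) • Submodule.Quotient.mk (tree K)) := by
    have := hs (n := 1) (m := 1) (N := 2) fun k hk => by
      obtain ⟨k, rfl⟩ := Nat.exists_eq_add_of_le' hk
      exact a11 k
    rw [Finset.sum_range_succ, Finset.sum_range_one, b11,
      show alphaZero K 1 1 = 0 from rfl] at this
    simpa using eq_neg_of_add_eq_zero_right this
  have f11 := congrArg (treeCoeff K) e11
  rw [adPow_succ, bracket_one_one h₀ (hz _), b10, map_add,
    treeCoeff_bracketPart_product K (by simpa using hξ 0 1), zero_add, map_neg, map_smul,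
    treeCoeff_tree, adPow_zero, show alphaDuf K 0 1 = differential K 1 from rfl, ← hR] at f11
  -- The first component where a quadratic term survives: it is the bracket of `ξ 1 0` with `e11`.
  have e21 := hs (n := 2) (m := 1) (N := 3) fun k hk => by
      obtain ⟨k, rfl⟩ := Nat.exists_eq_add_of_le' hk
      exact a21 k
  rw [Finset.sum_range_succ, Finset.sum_range_succ, Finset.sum_range_one, adPow_zero,
    alphaDuf_two K 0, alphaZero_two K 0, smul_zero, zero_add, adPow_succ K ξ 1, adPow_succ K ξ 0,
    bracket_two_one h₀ (hz _), bracket_two_one h₀ (adPow_succ K ξ 0 ▸ hz _), ← adPow_succ, d20, d20,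
    a10, a01, e11, b11, b10,
    adPow_zero, show alphaDuf K 0 1 = differential K 1 from rfl] at e21
  -- The first order term gives `1/2 * 1/2`; the second gives `1/2 * (-1/2) * 1/2`. The sum `1/8`
  -- would have to vanish.
  have f21 := congrArg (corollaCoeff K) e21
  simp only [map_add, map_smul, map_neg, map_zero, add_zero, zero_add] at f21
  rw [corollaCoeff_bracketPart_product K (by simpa using hξ 1 1),
    corollaCoeff_bracketPart_differential K (by simpa using hξ 2 0) e30,
    corollaCoeff_bracketPart_tree K (by simpa using hξ 1 0), ← hR, f11] at f21
  norm_num at f21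

end DufloGraph

theorem mainTheorem2 (K : Type*) [Field K] [CharZero K] :
    ¬ DufloGraph.GaugeEquiv K (DufloGraph.alphaDuf K) (DufloGraph.alphaZero K) := by
  rintro ⟨ξ, hξ, h⟩
  exact DufloGraph.not_gauge K hξ h
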